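/- Conventions. The functional graph $\mathcal G(f/S)$ of a map $f:S\to S$ is the directed graph with vertex set $S$ and edges $s\to f(s)$. Rooted trees are finite, with edges directed towards the root. $\bullet$ is the one-vertex tree; for a forest $G=\bigoplus_i T_i$ (disjoint union of rooted trees), $\langle G\rangle$ is the rooted tree whose root has as children exactly the roots of the $T_i$. For trees $\langle G\rangle,\langle H\rangle$ put $\langle G\rangle+\langle H\rangle=\langle G\oplus H\rangle$ and $k\cdot\langle G\rangle=\langle k\times G\rangle$, where $k\times G$ is the disjoint union of $k$ copies of $G$. $\operatorname{Cyc}(m,T)$ is the directed graph consisting of a directed $m$-cycle each of whose vertices is the root of a copy of $T$; $\operatorname{Cyc}(m)=\operatorname{Cyc}(m,\bullet)$ and $\{T\}=\operatorname{Cyc}(1,T)$. For a non-increasing sequence $v=(v_1,\dots,v_d)$ of positive integers, let $T_v^0=\bullet$, $T_v^k=\big\langle v_k\times T_v^{k-1}\oplus\bigoplus_{i=1}^{k-1}(v_i-v_{i+1})\times T_v^{i-1}\big\rangle$ for $1\le k<d$, and $\mathcal T_v=\big\langle (v_d-1)\times T_v^{d-1}\oplus\bigoplus_{i=1}^{d-1}(v_i-v_{i+1})\times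 T_v^{i-1}\big\rangle$. For positive integers $t,n$, let $\gcd_t(n)=(1)$ if $\gcd(t,n)=1$; otherwise $\gcd_t(n)=(n_1,\dots,n_D)$ with $n_1=\gcd(t,n)$, $n_{i+1}=\gcd\big(t,\tfrac{n}{n_1\cdots n_i}\big)$ and $D$ the least positive integer with $n_{D+1}=1$. Let $\varphi$ be Euler's totient function and $\operatorname{ord}_d(t)$ the multiplicative order of $t$ modulo $d$. Statement. Let $t$ be a positive integer, $p$ a prime, $q=p^s\ge 4$, and let $\mathbb G_q=\mathrm{PGL}(2,q)=\mathrm{GL}(2,q)/(\mathbb F_q^*\cdot I)$. Write $q-1=\nu_1\omega_1$ and $q+1=\nu_2\omega_2$, where $\omega_1$ (resp. $\omega_2$) is the greatest divisor of $q-1$ (resp. $q+1$) that is relatively prime to $t$, and put $d_1=\frac{q(q+1)}2$, $d_2=\frac{q(q-1)}2$. Then the functional graph of the map $\mathbb G_q\to\mathbb G_q$, $g\mapsto g^t$, is isomorphic to $$\left(\bigoplus_{i=1,2}\ \bigoplus_{\substack{d\mid\omega_i\\ d\ne1}}\frac{d_i\cdot\varphi(d)}{\operatorname{ord}_d(t)}\times\operatorname{Cyc}\big(\operatorname{ord}_d(t),\mathcal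 T_{\gcd_t(\nu_i)}\big)\right)\oplus\mathcal G,$$ where $$\mathcal G=\Big\{d_1\cdot\mathcal T_{\gcd_t(\nu_1)}+d_2\cdot\mathcal T_{\gcd_t(\nu_2)}+\tfrac{q^2-1}{p-1}\cdot\mathcal T_{(p)}\Big\}\quad\text{if }p\mid t,$$ $$\mathcal G=\frac{q^2-1}{\operatorname{ord}_p(t)}\times\operatorname{Cyc}(\operatorname{ord}_p(t))\ \oplus\ \Big\{d_1\cdot\mathcal T_{\gcd_t(\nu_1)}+d_2\cdot\mathcal T_{\gcd_t(\nu_2)}\Big\}\quad\text{if }p\nmid t.$$ -/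

import Mathlib

open scoped MatrixGroups

namespace PowerMapGraph

/-! ### Finite rooted trees -/

/-- Finite rooted trees. A forest is a list of trees, and `node F` is the rooted tree `⟨F⟩` whose
root has as children the roots of the trees of `F`. -/
inductive RTree : Type
  | node : List RTree → RTree

namespace RTree

/-- The forest `F` with `T = ⟨F⟩`. -/
def forest : RTree → List RTree
  | node F => F

/-- The tree `•` with a unique vertex. -/
def bullet : RTree := node []

/-- The sum of two rooted trees: the two roots are identified. -/
instance : Add RTree := ⟨fun S T => node (S.forest ++ T.forest)⟩

/-- `k • ⟨F⟩ = ⟨k × F⟩`: the roots of `k` copies of the tree are identified. -/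
instance : SMul ℕ RTree := ⟨fun k T => node (List.replicate k T.forest).flatten⟩

/-- The vertices of a rooted tree: the root, and the vertices of the subtrees at its children. -/
inductive Vertex : RTree → Type
  | root (F : List RTree) : Vertex (node F)
  | child {F : List RTree} (i : Fin F.length) (v : Vertex (F.get i)) : Vertex (node F)

/-- The root of a rooted tree. -/
def root : (T : RTree) → Vertex T
  | node F => Vertex.root F

/-- The edges of a rooted tree, directed towards the root. -/
inductive Edge : {T : RTree} → Vertex T → Vertex T → Prop
  | top {F : List RTree} (i : Fin F.length) :
      Edge (Vertex.child i (RTree.root (F.get i))) (Vertex.root F)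
  | child {F : List RTree} (i : Fin F.length) {u v : Vertex (F.get i)} :
      Edge u v → Edge (Vertex.child i u) (Vertex.child i v)

/-- The trees `T^k` attached to a sequence `ν 1, ν 2, …`: `T^0 = •` and
`T^k = ⟨ν k × T^(k-1) ⊕ ⨁_{i=1}^{k-1} (ν i - ν (i+1)) × T^(i-1)⟩`. -/
def level (ν : ℕ → ℕ) : ℕ → RTree
  | 0 => bullet
  | k + 1 => node (List.replicate (ν (k + 1)) (level ν k) ++
      (List.finRange k).flatMap fun i =>
        List.replicate (ν (i.val + 1) - ν (i.val + 2)) (level ν i.val))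
termination_by k => k
decreasing_by all_goals omega

/-- The elementary tree of a non-increasing sequence `v = (ν 1, …, ν d)` of positive integers:
`⟨(ν d - 1) × T^(d-1) ⊕ ⨁_{i=1}^{d-1} (ν i - ν (i+1)) × T^(i-1)⟩`. -/
def elementary (v : List ℕ) : RTree :=
  let ν : ℕ → ℕ := fun k => v.getD (k - 1) 0
  let d := v.length
  node (List.replicate (ν d - 1) (level ν (d - 1)) ++
    (List.finRange (d - 1)).flatMap fun i =>
      List.replicate (ν (i.val + 1) - ν (i.val + 2)) (level ν i.val))

end RTree

/-! ### The iterated gcd -/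

/-- The sequence `ν 1 = gcd (t, n)`, `ν (i+1) = gcd (t, n / (ν 1 ⋯ ν i))`, stopped just before its
first term equal to `1` (`n` is positive in all uses). -/
def gcdSeq (t n : ℕ) : List ℕ :=
  if _h : n = 0 ∨ Nat.gcd t n = 1 then []
  else Nat.gcd t n :: gcdSeq t (n / Nat.gcd t n)
termination_by n
decreasing_by
  have h0 : 0 < n := Nat.pos_of_ne_zero fun e => _h (Or.inl e)
  have hg : 0 < Nat.gcd t n := Nat.gcd_pos_of_pos_right t h0
  exact Nat.div_lt_self h0 (by omega)

/-- The iterated gcd of `n` relative to `t`; it is the sequence `(1)` if `gcd (t, n) = 1`. -/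
def iteratedGcd (t n : ℕ) : List ℕ :=
  if Nat.gcd t n = 1 then [1] else gcdSeq t n

/-! ### Directed graphs -/

/-- The functional graph of `f`: the edges are `x → f x`. -/
def functionalGraph {V : Type*} (f : V → V) : Digraph V where
  Adj x y := f x = y

/-- `Cyc (m, T)`: an `m`-cycle, each vertex of which is the root of a copy of `T`
(`m` is positive in all uses). -/
def Cyc (m : ℕ) (T : RTree) : Digraph (ZMod m × T.Vertex) where
  Adj x y := (x.1 = y.1 ∧ RTree.Edge x.2 y.2) ∨
    (y.1 = x.1 + 1 ∧ x.2 = T.root ∧ y.2 = T.root)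

/-- The disjoint union of two directed graphs. -/
def disjSum {V W : Type*} (G : Digraph V) (H : Digraph W) : Digraph (V ⊕ W) where
  Adj := Sum.LiftRel G.Adj H.Adj

/-- The edges of the disjoint union of a family of directed graphs. -/
inductive UnionAdj {ι : Type*} {V : ι → Type*} (G : (i : ι) → Digraph (V i)) :
    (Σ i, V i) → (Σ i, V i) → Prop
  | mk (i : ι) (x y : V i) : (G i).Adj x y → UnionAdj G ⟨i, x⟩ ⟨i, y⟩

/-- The disjoint union of a family of directed graphs. -/
def disjUnion {ι : Type*} {V : ι → Type*} (G : (i : ι) → Digraph (V i)) :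
    Digraph (Σ i, V i) where
  Adj := UnionAdj G

/-- `k × G`: the disjoint union of `k` copies of `G`. -/
def copies {V : Type*} (k : ℕ) (G : Digraph V) : Digraph (Σ _ : Fin k, V) :=
  disjUnion fun _ => G

/-- Two directed graphs are isomorphic. -/
def Isomorphic {V W : Type*} (G : Digraph V) (H : Digraph W) : Prop :=
  Nonempty (G.Adj ≃r H.Adj)

/-- The multiplicative order of `t` modulo `d`. -/
noncomputable def ord (d t : ℕ) : ℕ := orderOf (t : ZMod d)

/-- `⨁_{d ∣ ω, d ≠ 1} (c φ(d) / ord_d(t)) × Cyc (ord_d(t), T)`. -/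
noncomputable def cycleFamily (c ω t : ℕ) (T : RTree) :=
  disjUnion fun d : {d : ℕ // d ∣ ω ∧ d ≠ 1} =>
    copies (c * Nat.totient d / ord d t) (Cyc (ord d t) T)

end PowerMapGraph

/-!
`PGL(2, q)` is partitioned by cyclic subgroups meeting only in `1`: the centralizers of the elements
with two eigenvalues in the field are `q (q + 1) / 2` cyclic groups of order `q - 1`, those of the
elements without eigenvalues are `q (q - 1) / 2` cyclic groups of order `q + 1`, and the remaining
elements lie in `(q ^ 2 - 1) / (p - 1)` subgroups of order `p`. Powers stay in the same subgroup, so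
the graph of `g ↦ g ^ t` is obtained by gluing at `1` the graphs of the power map of these cyclic
groups.

In a cyclic group of order `n` the tree hanging at an element only depends on how long that element
stays in the images of the iterates of the power map, and the numbers of preimages are the orders of
successive kernels, which are the entries of the iterated gcd. Two maps whose cycles carry the same
trees are conjugate: a conjugacy between the cycles extends by recursion on the distance to a cycle.
-/

namespace PowerMapGraph

/-! ### Vertices of rooted trees -/

namespace RTree

/-- The subtree of `T` formed by a vertex and its descendants, as a rooted tree. -/
def subtree : {T : RTree} → Vertex T → RTree
  | _, .root F => node F
  | _, .child _ v => subtree v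

/-- The children of a vertex `v`, enumerated in the order of the forest of the subtree at `v`. -/
def childAt : {T : RTree} → (v : Vertex T) → Fin (subtree v).forest.length → Vertex T
  | _, .root F, j => .child j (root (F.get j))
  | _, .child i v, j => .child i (childAt v j)

open Classical in
/-- The parent of a vertex; the root is its own parent. -/
noncomputable def parent : {T : RTree} → Vertex T → Vertex T
  | _, .root F => .root F
  | _, @Vertex.child F i v => if v = root (F.get i) then .root F else .child i (parent v)

theorem subtree_root (T : RTree) : subtree T.root = T := by
  cases T; rfl

theorem child_ne_root {F : List RTree} (i : Fin F.length) (v : Vertex (F.get i)) :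
    Vertex.child i v ≠ (node F).root :=
  nofun

theorem parent_child_root {F : List RTree} (i : Fin F.length) :
    parent (Vertex.child i (root (F.get i))) = (node F).root :=
  if_pos rfl

theorem parent_child_of_ne_root {F : List RTree} {i : Fin F.length} {v : Vertex (F.get i)}
    (hv : v ≠ root (F.get i)) : parent (Vertex.child i v) = Vertex.child i (parent v) :=
  if_neg hv

@[elab_as_elim]
theorem parent_induction {T : RTree} {P : Vertex T → Prop} (root : P T.root)
    (of_parent : ∀ u, u ≠ T.root → P (parent u) → P u) (u : Vertex T) : P u := by
  induction u with
  | root F => exact root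
  | child i _ ih =>
    refine ih (P := fun w => P (.child i w)) (of_parent _ (child_ne_root _ _) ?_)
      fun w hw h => of_parent _ (child_ne_root _ _) ?_
    · rwa [parent_child_root]
    · rwa [parent_child_of_ne_root hw]

theorem edge_iff {T : RTree} (u v : Vertex T) : Edge u v ↔ u ≠ T.root ∧ parent u = v := by
  constructor
  · intro h
    induction h with
    | top i => exact ⟨child_ne_root _ _, parent_child_root i⟩
    | child i _ ih =>
      exact ⟨child_ne_root _ _, by rw [parent_child_of_ne_root ih.1, ih.2]⟩
  · rintro ⟨hu, rfl⟩
    induction u with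
    | root F => exact absurd rfl hu
    | @child F i w ih =>
      by_cases hw : w = root (F.get i)
      · rw [hw, parent_child_root]
        exact Edge.top i
      · rw [parent_child_of_ne_root hw]
        exact Edge.child i (ih hw)

theorem subtree_childAt {T : RTree} (v : Vertex T) (j : Fin (subtree v).forest.length) :
    subtree (childAt v j) = (subtree v).forest.get j := by
  induction v with
  | root F => exact subtree_root _
  | child i w ih => exact ih j

theorem childAt_injective {T : RTree} (v : Vertex T) : Function.Injective (childAt v) := by
  induction v with
  | root F =>
    intro j k h
    injection h
  | child i w ih =>
    intro j k h
    simp only [childAt, Vertex.child.injEq, heq_eq_eq, true_and] at h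
    exact ih h

theorem edge_childAt {T : RTree} (v : Vertex T) (j : Fin (subtree v).forest.length) :
    Edge (childAt v j) v := by
  induction v with
  | root F => exact Edge.top j
  | child i w ih => exact Edge.child i (ih j)

theorem range_childAt {T : RTree} (v : Vertex T) :
    Set.range (childAt v) = {u | u ≠ T.root ∧ parent u = v} := by
  ext u
  rw [Set.mem_ofPred_eq, ← edge_iff]
  constructor
  · rintro ⟨j, rfl⟩
    exact edge_childAt v j
  · intro h
    induction h with
    | top i => exact ⟨i, rfl⟩
    | child i _ ih =>
      obtain ⟨j, rfl⟩ := ih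
      exact ⟨j, rfl⟩

end RTree

/-! ### Functional graphs determined by their cycles and trees -/

/-- A description of a map `f` by its cycles and the trees hanging at them: `a` parametrizes the
vertices on the cycles, on which `f` acts as `r`, and the children of the root of the tree `c x`
correspond to the preimages of `x` off the cycles, with the trees assigned to them by `c`. -/
structure IsDecorated {V A : Type*} (f : V → V) (a : A → V) (r : A → A) (c : V → RTree) :
    Prop where
  injective : Function.Injective a
  semiconj : Function.Semiconj a r f
  eventually : ∀ x, ∃ n, f^[n] x ∈ Set.range a
  preimages : ∀ x, ∃ k : Fin (c x).forest.length → V, Function.Injective k ∧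
    Set.range k = {y | f y = x ∧ y ∉ Set.range a} ∧ ∀ j, c (k j) = (c x).forest.get j

namespace IsDecorated

variable {V W A : Type*} {f : V → V} {g : W → W} {a : A → V} {b : A → W} {r : A → A}
  {c : V → RTree} {c' : W → RTree}

@[elab_as_elim]
theorem induction (h : IsDecorated f a r c) {P : V → Prop} (cyclic : ∀ z, P (a z))
    (of_map : ∀ x, x ∉ Set.range a → P (f x) → P x) (x : V) : P x := by
  obtain ⟨n, hn⟩ := h.eventually x
  induction n generalizing x with
  | zero => obtain ⟨z, rfl⟩ := hn; exact cyclic z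
  | succ n ih =>
    by_cases hx : x ∈ Set.range a
    · obtain ⟨z, rfl⟩ := hx; exact cyclic z
    · exact of_map x hx (ih _ hn)

theorem wellFounded (h : IsDecorated f a r c) :
    WellFounded fun x y => f y = x ∧ y ∉ Set.range a := by
  refine ⟨fun x => ?_⟩
  induction x using h.induction with
  | cyclic z => exact ⟨_, fun y hy => absurd ⟨z, rfl⟩ hy.2⟩
  | of_map x _ ih => exact ⟨_, fun y hy => hy.1 ▸ ih⟩

/-- The enumeration of the preimages of `x` off the cycles by the children of the root of `c x`. -/
noncomputable def preimageEquiv (h : IsDecorated f a r c) (x : V) :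
    Fin (c x).forest.length ≃ {y // f y = x ∧ y ∉ Set.range a} :=
  (Equiv.ofInjective _ (h.preimages x).choose_spec.1).trans
    (Equiv.setCongr (h.preimages x).choose_spec.2.1)

theorem tree_preimageEquiv (h : IsDecorated f a r c) (x : V) (j : Fin (c x).forest.length) :
    c (h.preimageEquiv x j).1 = (c x).forest.get j :=
  (h.preimages x).choose_spec.2.2 j

/-- The matching of the preimages off the cycles of two vertices with the same tree. -/
noncomputable def branchEquiv (h : IsDecorated f a r c) (h' : IsDecorated g b r c') {x : V} {y : W}
    (hxy : c x = c' y) :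
    {u // f u = x ∧ u ∉ Set.range a} ≃ {v // g v = y ∧ v ∉ Set.range b} :=
  (h.preimageEquiv x).symm.trans ((finCongr (by rw [hxy])).trans (h'.preimageEquiv y))

theorem tree_branchEquiv (h : IsDecorated f a r c) (h' : IsDecorated g b r c') {x : V} {y : W}
    (hxy : c x = c' y) (u : {u // f u = x ∧ u ∉ Set.range a}) :
    c u.1 = c' (h.branchEquiv h' hxy u).1 := by
  obtain ⟨j, rfl⟩ := (h.preimageEquiv x).surjective u
  rw [branchEquiv, Equiv.trans_apply, Equiv.trans_apply, Equiv.symm_apply_apply,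
    h.tree_preimageEquiv, h'.tree_preimageEquiv]
  simp only [List.get_eq_getElem, finCongr_apply, Fin.val_cast, hxy]

section Extend

variable (h : IsDecorated f a r c) (h' : IsDecorated g b r c') (hc : ∀ z, c (a z) = c' (b z))

open Classical in
/-- The map `IsDecorated.extend` together with the fact that it preserves trees, on which its
recursive definition relies. -/
noncomputable def extendAux : (x : V) → {y : W // c x = c' y} :=
  h.wellFounded.fix fun x ih =>
    if hx : x ∈ Set.range a then ⟨b hx.choose, by rw [← hc, hx.choose_spec]⟩
    else ⟨h.branchEquiv h' (ih (f x) ⟨rfl, hx⟩).2 ⟨x, rfl, hx⟩,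
      h.tree_branchEquiv h' _ ⟨x, rfl, hx⟩⟩

/-- The isomorphism between two decorated maps with the same cycles and the same trees at them, by
recursion on the distance to the cycles: the matching of the cyclic vertices is extended along the
matchings `branchEquiv` of their preimages. -/
noncomputable def extend (x : V) : W := (h.extendAux h' hc x).1

theorem tree_extend (x : V) : c x = c' (h.extend h' hc x) := (h.extendAux h' hc x).2

theorem extend_cyclic (z : A) : h.extend h' hc (a z) = b z := by
  have hz : a z ∈ Set.range a := ⟨z, rfl⟩
  rw [extend, extendAux, WellFounded.fix_eq, dif_pos hz]
  exact congrArg b (h.injective hz.choose_spec)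

theorem extend_of_map_eq {x y : V} (hy : y ∉ Set.range a) (hxy : f y = x) :
    h.extend h' hc y = h.branchEquiv h' (h.tree_extend h' hc x) ⟨y, hxy, hy⟩ := by
  subst hxy
  rw [extend, extendAux, WellFounded.fix_eq, dif_neg hy]
  rfl

theorem extend_mem_range_iff (x : V) : h.extend h' hc x ∈ Set.range b ↔ x ∈ Set.range a := by
  refine ⟨fun hx => ?_, ?_⟩
  · by_contra hxa
    rw [h.extend_of_map_eq h' hc hxa rfl] at hx
    exact (h.branchEquiv h' _ _).2.2 hx
  · rintro ⟨z, rfl⟩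
    exact ⟨z, (h.extend_cyclic h' hc z).symm⟩

theorem semiconj_extend : Function.Semiconj (h.extend h' hc) f g := by
  intro x
  by_cases hx : x ∈ Set.range a
  · obtain ⟨z, rfl⟩ := hx
    rw [← h.semiconj.eq, extend_cyclic, extend_cyclic, h'.semiconj.eq]
  · rw [h.extend_of_map_eq h' hc hx rfl]
    exact (h.branchEquiv h' _ _).2.1.symm

theorem extend_injective : Function.Injective (h.extend h' hc) := by
  intro x
  induction x using h.induction with
  | cyclic z =>
    intro x hx
    obtain ⟨z', rfl⟩ : x ∈ Set.range a := by
      rw [← h.extend_mem_range_iff h' hc, ← hx, extend_mem_range_iff]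
      exact ⟨z, rfl⟩
    rw [extend_cyclic, extend_cyclic] at hx
    rw [h'.injective hx]
  | of_map x hx ih =>
    intro x' hxx'
    have hx' : x' ∉ Set.range a := by
      rwa [← h.extend_mem_range_iff h' hc, ← hxx', extend_mem_range_iff]
    have hf : f x = f x' := ih <| by
      rw [(h.semiconj_extend h' hc).eq, (h.semiconj_extend h' hc).eq, hxx']
    rw [h.extend_of_map_eq h' hc hx hf, h.extend_of_map_eq h' hc hx' rfl] at hxx'
    exact congrArg Subtype.val ((h.branchEquiv h' _).injective (Subtype.ext hxx'))

theorem extend_surjective : Function.Surjective (h.extend h' hc) := by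
  intro y
  induction y using h'.induction with
  | cyclic z => exact ⟨a z, h.extend_cyclic h' hc z⟩
  | of_map y hy ih =>
    obtain ⟨x, hx⟩ := ih
    obtain ⟨⟨u, hux, hu⟩, he⟩ :=
      (h.branchEquiv h' (h.tree_extend h' hc x)).surjective ⟨y, hx.symm, hy⟩
    exact ⟨u, by rw [h.extend_of_map_eq h' hc hu hux, he]⟩

end Extend

theorem isomorphic (h : IsDecorated f a r c) (h' : IsDecorated g b r c')
    (hc : ∀ z, c (a z) = c' (b z)) : Isomorphic (functionalGraph f) (functionalGraph g) := by
  refine ⟨⟨Equiv.ofBijective _ ⟨h.extend_injective h' hc, h.extend_surjective h' hc⟩, ?_⟩⟩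
  intro x y
  change g (h.extend h' hc x) = h.extend h' hc y ↔ f x = y
  rw [← (h.semiconj_extend h' hc).eq, (h.extend_injective h' hc).eq_iff]

end IsDecorated

/-! ### Disjoint unions and cycles as functional graphs -/

theorem disjSum_functionalGraph {V W : Type*} (f : V → V) (g : W → W) :
    disjSum (functionalGraph f) (functionalGraph g) = functionalGraph (Sum.map f g) := by
  ext (x | x) (y | y) <;> simp [disjSum, functionalGraph]

theorem disjUnion_functionalGraph {ι : Type*} {V : ι → Type*} (f : ∀ i, V i → V i) :
    disjUnion (fun i => functionalGraph (f i)) = functionalGraph (Sigma.map id f) := by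
  ext ⟨i, x⟩ ⟨j, y⟩
  constructor
  · rintro ⟨_, _, _, hxy⟩
    exact congrArg (Sigma.mk i) hxy
  · intro hxy
    cases hxy
    exact ⟨_, _, _, rfl⟩

theorem IsDecorated.sumMap {V W A B : Type*} {f : V → V} {g : W → W} {a : A → V} {b : B → W}
    {r : A → A} {s : B → B} {c : V → RTree} {c' : W → RTree}
    (h : IsDecorated f a r c) (h' : IsDecorated g b s c') :
    IsDecorated (Sum.map f g) (Sum.map a b) (Sum.map r s) (Sum.elim c c') where
  injective := h.injective.sumMap h'.injective
  semiconj := by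
    rintro (z | z) <;> simp [h.semiconj.eq, h'.semiconj.eq]
  eventually := by
    rintro (x | x)
    · obtain ⟨n, z, hz⟩ := h.eventually x
      have hn : Function.Semiconj Sum.inl f (Sum.map f g) := fun _ => rfl
      exact ⟨n, Sum.inl z, by rw [← (hn.iterate_right n).eq, ← hz]; rfl⟩
    · obtain ⟨n, z, hz⟩ := h'.eventually x
      have hn : Function.Semiconj Sum.inr g (Sum.map f g) := fun _ => rfl
      exact ⟨n, Sum.inr z, by rw [← (hn.iterate_right n).eq, ← hz]; rfl⟩
  preimages := by
    rintro (x | x)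
    · obtain ⟨k, hk, hr, hc⟩ := h.preimages x
      refine ⟨fun j => Sum.inl (k j), Sum.inl_injective.comp hk, ?_, hc⟩
      ext (y | y)
      · simpa using Set.ext_iff.1 hr y
      · simp
    · obtain ⟨k, hk, hr, hc⟩ := h'.preimages x
      refine ⟨fun j => Sum.inr (k j), Sum.inr_injective.comp hk, ?_, hc⟩
      ext (y | y)
      · simp
      · simpa using Set.ext_iff.1 hr y

theorem IsDecorated.sigmaMap {ι : Type*} {V A : ι → Type*} {f : ∀ i, V i → V i}
    {a : ∀ i, A i → V i} {r : ∀ i, A i → A i} {c : ∀ i, V i → RTree}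
    (h : ∀ i, IsDecorated (f i) (a i) (r i) (c i)) :
    IsDecorated (Sigma.map id f) (Sigma.map id a) (Sigma.map id r) (fun x => c x.1 x.2) where
  injective := Function.Injective.sigma_map Function.injective_id fun i => (h i).injective
  semiconj := by
    rintro ⟨i, z⟩
    simp [Sigma.map, (h i).semiconj.eq]
  eventually := by
    rintro ⟨i, x⟩
    obtain ⟨n, z, hz⟩ := (h i).eventually x
    have hn : Function.Semiconj (Sigma.mk i) (f i) (Sigma.map id f) := fun _ => rfl
    exact ⟨n, ⟨i, z⟩, by rw [← (hn.iterate_right n).eq, ← hz]; rfl⟩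
  preimages := by
    rintro ⟨i, x⟩
    obtain ⟨k, hk, hr, hc⟩ := (h i).preimages x
    refine ⟨fun j => ⟨i, k j⟩, sigma_mk_injective.comp hk, ?_, hc⟩
    have hrange : Set.range (Sigma.map id a) = {z | z.2 ∈ Set.range (a z.1)} := by
      ext ⟨i', y⟩
      simp [Sigma.map, Sigma.exists, Sigma.ext_iff]
    have hmap : Set.range (fun j => (⟨i, k j⟩ : Σ i, V i)) = Sigma.mk i '' Set.range k :=
      Set.range_comp (Sigma.mk i) k
    rw [hmap, hr, hrange]
    ext ⟨i', y⟩
    constructor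
    · rintro ⟨y, ⟨rfl, hy⟩, hxy⟩
      cases hxy
      exact ⟨rfl, hy⟩
    · rintro ⟨hxy, hy⟩
      cases hxy
      exact ⟨y, ⟨rfl, hy⟩, rfl⟩

open Classical in
/-- The map whose functional graph is `Cyc m T`. -/
noncomputable def cycMap (m : ℕ) (T : RTree) (x : ZMod m × T.Vertex) : ZMod m × T.Vertex :=
  if x.2 = T.root then (x.1 + 1, T.root) else (x.1, RTree.parent x.2)

theorem Cyc_eq_functionalGraph (m : ℕ) (T : RTree) : Cyc m T = functionalGraph (cycMap m T) := by
  ext ⟨i, u⟩ ⟨j, v⟩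
  by_cases hu : u = T.root <;>
    simp [Cyc, functionalGraph, cycMap, RTree.edge_iff, hu, eq_comm]

theorem isDecorated_cycMap (m : ℕ) (T : RTree) :
    IsDecorated (cycMap m T) (fun z => (z, T.root)) (fun z => z + 1)
      (fun x => RTree.subtree x.2) where
  injective := fun x y hxy => (Prod.ext_iff.1 hxy).1
  semiconj := fun z => by simp [cycMap]
  eventually := by
    rintro ⟨i, u⟩
    induction u using RTree.parent_induction with
    | root => exact ⟨0, i, rfl⟩
    | of_parent u hu ih =>
      obtain ⟨n, hn⟩ := ih
      exact ⟨n + 1, by rwa [Function.iterate_succ_apply, cycMap, if_neg hu]⟩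
  preimages := by
    rintro ⟨i, v⟩
    refine ⟨fun j => (i, RTree.childAt v j),
      fun j k hjk => RTree.childAt_injective v (Prod.ext_iff.1 hjk).2, ?_, RTree.subtree_childAt v⟩
    ext ⟨i', u⟩
    have hchild := Set.ext_iff.1 (RTree.range_childAt v) u
    simp only [Set.mem_range, Set.mem_ofPred_eq] at hchild
    by_cases hu : u = T.root <;> simp_all [cycMap, eq_comm]

/-! ### Permutations all of whose cycles have the same length -/

section Cycles

variable {X : Type*} {f : X → X} {m : ℕ}

/-- The equivalence relation whose classes are the cycles of a map all of whose points have minimal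
period `m`. -/
def cycleSetoid (hm : 0 < m) (hf : ∀ x, Function.minimalPeriod f x = m) : Setoid X where
  r x y := ∃ l, f^[l] x = y
  iseqv := by
    refine ⟨fun x => ⟨0, rfl⟩, ?_, ?_⟩
    · rintro x _ ⟨l, rfl⟩
      refine ⟨m * l - l, ?_⟩
      rw [← Function.iterate_add_apply, Nat.sub_add_cancel (Nat.le_mul_of_pos_left l hm)]
      exact (Function.isPeriodicPt_iff_minimalPeriod_dvd.2 ⟨l, by rw [hf]⟩).eq
    · rintro x _ _ ⟨l, rfl⟩ ⟨l', rfl⟩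
      exact ⟨l' + l, Function.iterate_add_apply _ _ _ _⟩

/-- The parametrization of the points by a cycle, on which a base point is chosen, and the number of
steps from the base point. -/
noncomputable def cycleParam (hm : 0 < m) (hf : ∀ x, Function.minimalPeriod f x = m)
    (a : Quotient (cycleSetoid hm hf) × ZMod m) : X :=
  f^[a.2.val] a.1.out

variable (hm : 0 < m) (hf : ∀ x, Function.minimalPeriod f x = m)

theorem mk_cycleParam (a : Quotient (cycleSetoid hm hf) × ZMod m) :
    Quotient.mk (cycleSetoid hm hf) (cycleParam hm hf a) = a.1 := by
  conv_rhs => rw [← Quotient.out_eq a.1]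
  exact Quotient.sound ((cycleSetoid hm hf).symm ⟨a.2.val, rfl⟩)

theorem cycleParam_natCast (c : Quotient (cycleSetoid hm hf)) (l : ℕ) :
    cycleParam hm hf (c, (l : ZMod m)) = f^[l] c.out := by
  rw [cycleParam, ZMod.val_natCast]
  simpa only [hf] using Function.iterate_mod_minimalPeriod_eq (f := f) (x := c.out) (n := l)

theorem cycleParam_add_one (c : Quotient (cycleSetoid hm hf)) (z : ZMod m) :
    cycleParam hm hf (c, z + 1) = f (cycleParam hm hf (c, z)) := by
  have : NeZero m := ⟨hm.ne'⟩
  obtain ⟨l, rfl⟩ := ZMod.natCast_zmod_surjective z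
  rw [← Nat.cast_succ, cycleParam_natCast, cycleParam_natCast, Function.iterate_succ_apply']

theorem bijective_cycleParam : Function.Bijective (cycleParam hm hf) := by
  have : NeZero m := ⟨hm.ne'⟩
  constructor
  · rintro ⟨c, y⟩ ⟨c', z⟩ h
    obtain rfl : c = c' :=
      (mk_cycleParam hm hf (c, y)).symm.trans (h ▸ mk_cycleParam hm hf (c', z))
    have hval := (Function.iterate_eq_iterate_iff_of_lt_minimalPeriod (f := f) (x := c.out)
      (by rw [hf]; exact ZMod.val_lt y) (by rw [hf]; exact ZMod.val_lt z)).1 h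
    exact congrArg (Prod.mk c) (ZMod.val_injective m hval)
  · intro x
    obtain ⟨l, hl⟩ := Quotient.exact (Quotient.out_eq (Quotient.mk (cycleSetoid hm hf) x))
    exact ⟨(Quotient.mk _ x, (l : ZMod m)), (cycleParam_natCast hm hf _ l).trans hl⟩

theorem exists_equiv_sigma_zmod [Finite X] (hm : 0 < m)
    (hf : ∀ x, Function.minimalPeriod f x = m) :
    ∃ e : (Σ _ : Fin (Nat.card X / m), ZMod m) ≃ X, ∀ j z, e ⟨j, z + 1⟩ = f (e ⟨j, z⟩) := by
  have hcard : Nat.card (Quotient (cycleSetoid hm hf)) = Nat.card X / m := by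
    rw [← Nat.card_congr (Equiv.ofBijective _ (bijective_cycleParam hm hf)), Nat.card_prod,
      Nat.card_zmod, Nat.mul_div_cancel _ hm]
  refine ⟨(Equiv.sigmaEquivProd _ _).trans
    (((Finite.equivFinOfCardEq hcard).symm.prodCongr (Equiv.refl _)).trans
      (Equiv.ofBijective _ (bijective_cycleParam hm hf))), fun j z => ?_⟩
  exact cycleParam_add_one hm hf _ z

end Cycles

/-! ### The orders of the images of the iterated power map on a cyclic group -/

/-- The order of the image of the `t`-th power map on a cyclic group of order `m`. -/
def powImageCard (t m : ℕ) : ℕ := m / Nat.gcd t m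

theorem powImageCard_dvd (t m : ℕ) : powImageCard t m ∣ m :=
  Nat.div_dvd_of_dvd (Nat.gcd_dvd_right t m)

theorem powImageCard_pos (t : ℕ) {m : ℕ} (hm : 0 < m) : 0 < powImageCard t m :=
  Nat.pos_of_dvd_of_pos (powImageCard_dvd t m) hm

theorem powImageCard_of_coprime {t m : ℕ} (h : Nat.Coprime t m) : powImageCard t m = m := by
  rw [powImageCard, h.gcd_eq_one, Nat.div_one]

theorem mul_powImageCard (t m : ℕ) : t * powImageCard t m = m * (t / Nat.gcd t m) := by
  rw [powImageCard, ← Nat.mul_div_assoc _ (Nat.gcd_dvd_right t m), mul_comm m,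
    Nat.div_mul_right_comm (Nat.gcd_dvd_left t m)]

theorem powImageCard_mul_of_coprime {t ω : ℕ} (h : Nat.Coprime t ω) (m : ℕ) :
    powImageCard t (m * ω) = powImageCard t m * ω := by
  rw [powImageCard, Nat.Coprime.gcd_mul_right_cancel_right _ h.symm,
    ← Nat.div_mul_right_comm (Nat.gcd_dvd_right _ _), powImageCard]

theorem iterate_powImageCard_dvd_of_le (t m : ℕ) {i j : ℕ} (hij : i ≤ j) :
    (powImageCard t)^[j] m ∣ (powImageCard t)^[i] m := by
  induction j, hij using Nat.le_induction with
  | base => exact dvd_rfl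
  | succ j _ ih =>
    rw [Function.iterate_succ_apply']
    exact (powImageCard_dvd _ _).trans ih

theorem iterate_powImageCard_dvd (t m i : ℕ) : (powImageCard t)^[i] m ∣ m :=
  iterate_powImageCard_dvd_of_le t m (Nat.zero_le i)

theorem iterate_powImageCard_mul_of_coprime {t ω : ℕ} (h : Nat.Coprime t ω) (m i : ℕ) :
    (powImageCard t)^[i] (m * ω) = (powImageCard t)^[i] m * ω := by
  have hω : Function.Semiconj (· * ω) (powImageCard t) (powImageCard t) :=
    fun m => (powImageCard_mul_of_coprime h m).symm
  exact ((hω.iterate_right i).eq m).symm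

/-- The sequence `v` lists the orders of the kernels of the `t`-th power map on the successive
images of its iterates on a cyclic group of order `n`, up to an image of order `ω`, on which the map
is bijective. -/
structure IsKernelSeq (t n ω : ℕ) (v : List ℕ) : Prop where
  pos : 0 < n
  length_pos : 0 < v.length
  getD_eq : ∀ i < v.length, v.getD i 0 = Nat.gcd t ((powImageCard t)^[i] n)
  iterate_eq : (powImageCard t)^[v.length] n = ω
  coprime : Nat.Coprime t ω

theorem gcdSeq_cons {t n : ℕ} (hn : 0 < n) (h : Nat.gcd t n ≠ 1) :
    gcdSeq t n = Nat.gcd t n :: gcdSeq t (powImageCard t n) := by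
  rw [gcdSeq, dif_neg (by simp [h, hn.ne']), powImageCard]

theorem gcdSeq_of_coprime {t n : ℕ} (h : Nat.Coprime t n) : gcdSeq t n = [] := by
  rw [gcdSeq, dif_pos (Or.inr h)]

theorem gcdSeq_spec (t : ℕ) {n : ℕ} (hn : 0 < n) :
    (∀ i < (gcdSeq t n).length, (gcdSeq t n).getD i 0 = Nat.gcd t ((powImageCard t)^[i] n)) ∧
      Nat.Coprime t ((powImageCard t)^[(gcdSeq t n).length] n) := by
  induction n using Nat.strong_induction_on with
  | _ n ih =>
    by_cases h : Nat.gcd t n = 1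
    · rw [gcdSeq_of_coprime h]
      exact ⟨fun i hi => absurd hi (Nat.not_lt_zero i), h⟩
    · have hlt : powImageCard t n < n :=
        Nat.div_lt_self hn (by have := Nat.gcd_pos_of_pos_right t hn; omega)
      obtain ⟨hget, hcop⟩ := ih _ hlt (powImageCard_pos t hn)
      rw [gcdSeq_cons hn h]
      refine ⟨?_, hcop⟩
      rintro (_ | i) hi
      · rfl
      · exact hget i (Nat.succ_lt_succ_iff.1 hi)

theorem isKernelSeq_singleton {n t : ℕ} (hn : 0 < n) (h : Nat.Coprime t (powImageCard t n)) :
    IsKernelSeq t n (powImageCard t n) [Nat.gcd t n] where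
  pos := hn
  length_pos := Nat.one_pos
  getD_eq := by
    intro i hi
    obtain rfl : i = 0 := Nat.lt_one_iff.1 hi
    rfl
  iterate_eq := rfl
  coprime := h

theorem isKernelSeq_iteratedGcd_iterate (t : ℕ) {n : ℕ} (hn : 0 < n) :
    IsKernelSeq t n ((powImageCard t)^[(iteratedGcd t n).length] n) (iteratedGcd t n) := by
  by_cases h : Nat.gcd t n = 1
  · rw [iteratedGcd, if_pos h, ← h]
    exact isKernelSeq_singleton hn (by rwa [powImageCard_of_coprime h])
  · rw [iteratedGcd, if_neg h]
    obtain ⟨hget, hcop⟩ := gcdSeq_spec t hn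
    exact ⟨hn, by rw [gcdSeq_cons hn h]; exact Nat.succ_pos _, hget, rfl, hcop⟩

theorem IsKernelSeq.mul_of_coprime {t n ω ω' : ℕ} {v : List ℕ} (h : IsKernelSeq t n ω v)
    (hω' : 0 < ω') (hcop : Nat.Coprime t ω') : IsKernelSeq t (n * ω') (ω * ω') v where
  pos := Nat.mul_pos h.pos hω'
  length_pos := h.length_pos
  getD_eq i hi := by
    rw [h.getD_eq i hi, iterate_powImageCard_mul_of_coprime hcop,
      Nat.Coprime.gcd_mul_right_cancel_right _ hcop.symm]
  iterate_eq := by rw [iterate_powImageCard_mul_of_coprime hcop, h.iterate_eq]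
  coprime := h.coprime.mul_right hcop

theorem isKernelSeq_iteratedGcd {t n ν ω : ℕ} (hn : 0 < n) (h : n = ν * ω)
    (hω : IsGreatest {d : ℕ | d ∣ n ∧ Nat.Coprime d t} ω) :
    IsKernelSeq t n ω (iteratedGcd t ν) := by
  obtain ⟨⟨-, hcop⟩, hmax⟩ := hω
  subst h
  have hν := isKernelSeq_iteratedGcd_iterate t (Nat.pos_of_mul_pos_right hn)
  set ω₀ := (powImageCard t)^[(iteratedGcd t ν).length] ν
  have hω := Nat.pos_of_mul_pos_left hn
  have hle : ω₀ * ω ≤ ω := hmax ⟨Nat.mul_dvd_mul_right (iterate_powImageCard_dvd t ν _) ω,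
    (hν.coprime.mul_right hcop.symm).symm⟩
  have hpos : 0 < ω₀ :=
    Nat.pos_of_dvd_of_pos (iterate_powImageCard_dvd t ν _) (Nat.pos_of_mul_pos_right hn)
  obtain hω₀ : ω₀ = 1 := by nlinarith
  simpa only [hω₀, one_mul] using hν.mul_of_coprime hω hcop.symm

theorem isKernelSeq_prime_of_dvd {p t : ℕ} (hp : p.Prime) (h : p ∣ t) :
    IsKernelSeq t p 1 [p] := by
  have hgcd := Nat.gcd_eq_right h
  have himage : powImageCard t p = 1 := by rw [powImageCard, hgcd, Nat.div_self hp.pos]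
  have := isKernelSeq_singleton hp.pos (himage ▸ Nat.coprime_one_right t)
  rwa [himage, hgcd] at this

theorem isKernelSeq_of_coprime {n t : ℕ} (hn : 0 < n) (h : Nat.Coprime t n) :
    IsKernelSeq t n n [1] := by
  have himage := powImageCard_of_coprime h
  have := isKernelSeq_singleton hn (himage.symm ▸ h)
  rwa [himage, h.gcd_eq_one] at this

theorem IsKernelSeq.dvd {t n ω : ℕ} {v : List ℕ} (h : IsKernelSeq t n ω v) : ω ∣ n :=
  h.iterate_eq ▸ iterate_powImageCard_dvd t n _

/-! ### The trees hanging at the elements of a cyclic group -/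

theorem coe_replicate_append_flatMap {β : Type*} (N : ℕ → ℕ) (L : ℕ → β) (k : ℕ) :
    ((List.replicate (N k - N (k + 1)) (L k) ++ (List.finRange k).flatMap fun i =>
        List.replicate (N i.val - N (i.val + 1)) (L i.val) : List β) : Multiset β) =
      ∑ i ∈ Finset.range (k + 1), Multiset.replicate (N i - N (i + 1)) (L i) := by
  rw [← Multiset.coe_add, ← Multiset.coe_bind, Multiset.bind, Multiset.join, Multiset.map_coe,
    Multiset.sum_coe, Finset.sum_range_succ, Finset.sum_range, Fin.sum_univ_def, add_comm]
  rfl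

theorem coe_forest_level {ν N : ℕ → ℕ} {k : ℕ} (hN : ∀ i < k, N i = ν (i + 1)) (hk : N k = 0) :
    ((RTree.level ν k).forest : Multiset RTree) =
      ∑ i ∈ Finset.range k, Multiset.replicate (N i - N (i + 1)) (RTree.level ν i) := by
  cases k with
  | zero => rw [RTree.level]; rfl
  | succ k =>
    rw [← coe_replicate_append_flatMap, hk, hN k k.lt_succ_self, RTree.level, RTree.forest,
      Nat.sub_zero]
    congr! 5 with i
    rw [hN i (by omega), hN (i + 1) (by omega)]

theorem coe_forest_elementary {v : List ℕ} (hv : 0 < v.length) {N : ℕ → ℕ}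
    (hN : ∀ i < v.length, N i = v.getD i 0) (hlast : N v.length = 1) :
    ((RTree.elementary v).forest : Multiset RTree) =
      ∑ i ∈ Finset.range v.length, Multiset.replicate (N i - N (i + 1))
        (RTree.level (fun k => v.getD (k - 1) 0) i) := by
  obtain ⟨k, hk⟩ : ∃ k, v.length = k + 1 := ⟨v.length - 1, by omega⟩
  have hforest : (RTree.elementary v).forest =
      List.replicate (v.getD (v.length - 1) 0 - 1)
          (RTree.level (fun k => v.getD (k - 1) 0) (v.length - 1)) ++
        (List.finRange (v.length - 1)).flatMap fun i =>
          List.replicate (v.getD i.val 0 - v.getD (i.val + 1) 0)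
            (RTree.level (fun k => v.getD (k - 1) 0) i.val) := rfl
  rw [hforest, hk, Nat.add_sub_cancel]
  rw [hk] at hN hlast
  rw [← coe_replicate_append_flatMap, hlast, hN k k.lt_succ_self]
  congr! 5 with i
  rw [hN i (by omega), hN (i + 1) (by omega)]

/-- The largest `i ≤ D` such that the elements of order `o` of a cyclic group of order `n` are in
the image of the `i`-th iterate of the `t`-th power map. -/
def powDepth (t n D o : ℕ) : ℕ :=
  Nat.findGreatest (fun i => o ∣ (powImageCard t)^[i] n) D

theorem le_powDepth_iff {t n D o i : ℕ} (ho : o ∣ n) (hi : i ≤ D) :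
    i ≤ powDepth t n D o ↔ o ∣ (powImageCard t)^[i] n := by
  refine ⟨fun h => ?_, fun h => Nat.le_findGreatest hi h⟩
  have hspec : o ∣ (powImageCard t)^[powDepth t n D o] n :=
    Nat.findGreatest_spec (P := fun i => o ∣ (powImageCard t)^[i] n) (Nat.zero_le D) ho
  exact hspec.trans (iterate_powImageCard_dvd_of_le t n h)

/-- The tree hanging at an element of order `o` of a cyclic group of order `n` in the graph of the
`t`-th power map, where `v` is the sequence of the orders of the kernels and the periodic elements
form the subgroup of order `ω`. -/
def hangingTree (t n ω : ℕ) (v : List ℕ) (o : ℕ) : RTree :=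
  if o ∣ ω then RTree.elementary v
  else RTree.level (fun k => v.getD (k - 1) 0) (powDepth t n v.length o)

/-- The number of `t`-th roots of an element of order `o` of a cyclic group of order `n` in the
image of the `i`-th iterate of the `t`-th power map. -/
def rootCount (t n o i : ℕ) : ℕ :=
  if o ∣ (powImageCard t)^[i + 1] n then Nat.gcd t ((powImageCard t)^[i] n) else 0

namespace IsKernelSeq

variable {t n ω : ℕ} {v : List ℕ}

theorem dvd_iff (h : IsKernelSeq t n ω v) {o : ℕ} (ho : o ∣ n) :
    o ∣ ω ↔ v.length ≤ powDepth t n v.length o := by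
  rw [le_powDepth_iff ho le_rfl, h.iterate_eq]

theorem coe_forest_hangingTree (h : IsKernelSeq t n ω v) {o : ℕ} (ho : o ∣ n) :
    ((hangingTree t n ω v o).forest : Multiset RTree) =
      ∑ i ∈ Finset.range v.length, Multiset.replicate
        (rootCount t n o i - rootCount t n o (i + 1))
        (RTree.level (fun k => v.getD (k - 1) 0) i) := by
  have hroot : ∀ i < v.length, i < powDepth t n v.length o → rootCount t n o i = v.getD i 0 := by
    intro i hi hio
    rw [rootCount, if_pos ((le_powDepth_iff ho hi).1 hio), h.getD_eq i hi]
  rw [hangingTree]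
  split_ifs with hω
  · have hdepth := (h.dvd_iff ho).1 hω
    refine coe_forest_elementary h.length_pos (fun i hi => hroot i hi (hi.trans_le hdepth)) ?_
    rw [rootCount, Function.iterate_succ_apply', h.iterate_eq, powImageCard_of_coprime h.coprime,
      if_pos hω, h.coprime.gcd_eq_one]
  · have hdepth := not_le.1 (mt (h.dvd_iff ho).2 hω)
    have hzero : ∀ i, powDepth t n v.length o ≤ i → rootCount t n o i = 0 := by
      intro i hi
      refine if_neg fun hdvd => Nat.not_succ_le_self (powDepth t n v.length o) ?_
      exact (le_powDepth_iff ho hdepth).2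
        (hdvd.trans (iterate_powImageCard_dvd_of_le t n (Nat.succ_le_succ hi)))
    rw [coe_forest_level (fun i hi => hroot i (hi.trans hdepth) hi) (hzero _ le_rfl)]
    refine Finset.sum_subset (Finset.range_subset_range.2 hdepth.le) fun i _ hi => ?_
    rw [hzero i (by simpa using hi), Nat.zero_sub, Multiset.replicate_zero]

end IsKernelSeq

theorem orderOf_pow_dvd_powImageCard {G : Type*} [Monoid G] (t : ℕ) {m : ℕ} {y : G}
    (hy : orderOf y ∣ m) : orderOf (y ^ t) ∣ powImageCard t m := by
  rw [orderOf_dvd_iff_pow_eq_one] at hy ⊢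
  rw [← pow_mul, mul_powImageCard, pow_mul, hy, one_pow]

section CyclicGroup

variable {C : Type*} [CommGroup C] [IsCyclic C]

theorem exists_pow_eq_and_pow_eq_one [Finite C] (t : ℕ) {m : ℕ} (hm : m ∣ Nat.card C) {x : C}
    (hx : x ^ powImageCard t m = 1) : ∃ y : C, y ^ t = x ∧ y ^ m = 1 := by
  let K : Subgroup C := (powMonoidHom m).ker
  let H : Subgroup C := (powMonoidHom t : K →* K).range.map K.subtype
  have hK : Nat.card K = m := by
    rw [IsCyclic.card_powMonoidHom_ker, Nat.gcd_eq_right hm]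
  have hH : Nat.card H = powImageCard t m := by
    rw [Subgroup.card_map_of_injective K.subtype_injective, IsCyclic.card_powMonoidHom_range, hK,
      powImageCard, Nat.gcd_comm]
  have hle : H ≤ (powMonoidHom (powImageCard t m)).ker := by
    rintro _ ⟨_, ⟨y, rfl⟩, rfl⟩
    have hy : orderOf (y : C) ∣ m := orderOf_dvd_of_pow_eq_one y.2
    exact orderOf_dvd_iff_pow_eq_one.1 (orderOf_pow_dvd_powImageCard t hy)
  have hx' : x ∈ H := by
    rw [Subgroup.eq_of_le_of_card_ge hle]
    · exact hx
    · rw [IsCyclic.card_powMonoidHom_ker, hH,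
        Nat.gcd_eq_right ((powImageCard_dvd t m).trans hm)]
  obtain ⟨_, ⟨y, rfl⟩, rfl⟩ := hx'
  exact ⟨y, rfl, y.2⟩

variable [Fintype C] [DecidableEq C]

theorem card_filter_pow_eq_one (m : ℕ) :
    (Finset.univ.filter fun y : C => y ^ m = 1).card = Nat.gcd (Nat.card C) m := by
  rw [← IsCyclic.card_powMonoidHom_ker, Nat.card_eq_fintype_card, Fintype.card_subtype]
  simp only [MonoidHom.mem_ker, powMonoidHom_apply]

theorem card_filter_pow_eq_and_orderOf_dvd (t : ℕ) {m : ℕ} (hm : m ∣ Nat.card C) (x : C) :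
    (Finset.univ.filter fun y : C => y ^ t = x ∧ orderOf y ∣ m).card =
      if orderOf x ∣ powImageCard t m then Nat.gcd t m else 0 := by
  split_ifs with hx
  · obtain ⟨z, rfl, hz⟩ := exists_pow_eq_and_pow_eq_one t hm (orderOf_dvd_iff_pow_eq_one.1 hx)
    trans (Finset.univ.filter fun y : C => y ^ Nat.gcd t m = 1).card
    · refine (Finset.card_equiv (Equiv.mulLeft z) fun y => ?_).symm
      simp [orderOf_dvd_iff_pow_eq_one, mul_pow, hz, pow_gcd_eq_one]
    · rw [card_filter_pow_eq_one, Nat.gcd_eq_right ((Nat.gcd_dvd_right t m).trans hm)]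
  · rw [Finset.card_eq_zero, Finset.filter_eq_empty_iff]
    rintro y - ⟨rfl, hy⟩
    exact hx (orderOf_pow_dvd_powImageCard t hy)

theorem card_filter_powDepth_eq {t n ω i D : ℕ} (hn : Nat.card C = n)
    (hω : (powImageCard t)^[D] n = ω) (hi : i < D) (x : C) :
    (Finset.univ.filter fun y : C =>
        (y ^ t = x ∧ ¬ orderOf y ∣ ω) ∧ powDepth t n D (orderOf y) = i).card =
      rootCount t n (orderOf x) i - rootCount t n (orderOf x) (i + 1) := by
  have hroot : ∀ j, rootCount t n (orderOf x) j = (Finset.univ.filter fun y : C =>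
      y ^ t = x ∧ orderOf y ∣ (powImageCard t)^[j] n).card := by
    intro j
    rw [card_filter_pow_eq_and_orderOf_dvd t (hn ▸ iterate_powImageCard_dvd t _ j), rootCount,
      Function.iterate_succ_apply']
  rw [hroot, hroot, ← Finset.card_sdiff_of_subset]
  · congr 1
    ext y
    have ho : orderOf y ∣ n := hn ▸ orderOf_dvd_natCard y
    have hdepth := @le_powDepth_iff t n D (orderOf y)
    have hlast : orderOf y ∣ ω ↔ D ≤ powDepth t n D (orderOf y) := by
      rw [hdepth ho le_rfl, hω]
    simp only [Finset.mem_filter, Finset.mem_univ, true_and, Finset.mem_sdiff, hlast,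
      ← hdepth ho hi.le, ← hdepth (i := i + 1) ho hi]
    grind
  · intro y
    simp only [Finset.mem_filter, Finset.mem_univ, true_and]
    exact fun hy => ⟨hy.1, hy.2.trans (iterate_powImageCard_dvd_of_le t n (Nat.le_succ i))⟩

end CyclicGroup

theorem map_val_eq_sum_replicate {α β : Type*} (s : Finset α) {d : α → ℕ} {k : ℕ}
    (hd : ∀ y ∈ s, d y < k) (L : ℕ → β) :
    s.val.map (fun y => L (d y)) =
      ∑ i ∈ Finset.range k, Multiset.replicate (s.filter fun y => d y = i).card (L i) := by
  have hfiber : ∀ i, Multiset.replicate (s.filter fun y => d y = i).card (L i) =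
      ∑ y ∈ s with d y = i, ({L (d y)} : Multiset β) := by
    intro i
    rw [Finset.sum_congr rfl fun y hy => by rw [(Finset.mem_filter.1 hy).2], Finset.sum_const,
      Multiset.nsmul_singleton]
  simp only [hfiber]
  rw [Finset.sum_fiberwise_of_maps_to fun y hy => Finset.mem_range.2 (hd y hy),
    ← Multiset.sum_map_singleton (s.val.map _), Multiset.map_map]
  rfl

theorem IsKernelSeq.map_hangingTree {t n ω : ℕ} {v : List ℕ} (h : IsKernelSeq t n ω v)
    {C : Type*} [CommGroup C] [IsCyclic C] [Fintype C] [DecidableEq C] (hn : Nat.card C = n)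
    (x : C) :
    (Finset.univ.filter fun y : C => y ^ t = x ∧ ¬ orderOf y ∣ ω).val.map
        (fun y => hangingTree t n ω v (orderOf y)) =
      ((hangingTree t n ω v (orderOf x)).forest : Multiset RTree) := by
  have ho : ∀ y : C, orderOf y ∣ n := fun y => hn ▸ orderOf_dvd_natCard y
  rw [h.coe_forest_hangingTree (ho x)]
  trans (Finset.univ.filter fun y : C => y ^ t = x ∧ ¬ orderOf y ∣ ω).val.map
    fun y => RTree.level (fun k => v.getD (k - 1) 0) (powDepth t n v.length (orderOf y))
  · exact Multiset.map_congr rfl fun y hy => if_neg (Finset.mem_filter.1 hy).2.2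
  · rw [map_val_eq_sum_replicate (d := fun y => powDepth t n v.length (orderOf y))
      (k := v.length)]
    · refine Finset.sum_congr rfl fun i hi => ?_
      rw [Finset.filter_filter,
        card_filter_powDepth_eq hn h.iterate_eq (Finset.mem_range.1 hi)]
    · intro y hy
      exact not_le.1 (mt (h.dvd_iff (ho y)).2 (Finset.mem_filter.1 hy).2.2)

theorem IsKernelSeq.map_hangingTree_subgroup {t n ω : ℕ} {v : List ℕ} (h : IsKernelSeq t n ω v)
    {G : Type*} [Group G] [Fintype G] [DecidableEq G] (H : Subgroup G) [DecidablePred (· ∈ H)]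
    [IsCyclic H] (hn : Nat.card H = n) {x : G} (hx : x ∈ H) :
    (Finset.univ.filter fun y : G => y ∈ H ∧ y ^ t = x ∧ ¬ orderOf y ∣ ω).val.map
        (fun y => hangingTree t n ω v (orderOf y)) =
      ((hangingTree t n ω v (orderOf x)).forest : Multiset RTree) := by
  let _ : CommGroup H := IsCyclic.commGroup
  have hmap : (Finset.univ.filter fun y : G => y ∈ H ∧ y ^ t = x ∧ ¬ orderOf y ∣ ω) =
      (Finset.univ.filter fun y : H => y ^ t = ⟨x, hx⟩ ∧ ¬ orderOf y ∣ ω).map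
        (Function.Embedding.subtype _) := by
    ext y
    simp only [Finset.mem_filter, Finset.mem_univ, true_and, Finset.mem_map,
      Function.Embedding.subtype_apply, Subtype.exists, Subgroup.orderOf_mk, Subtype.ext_iff,
      SubmonoidClass.coe_pow, exists_and_right, exists_eq_right, exists_prop]
    grind
  rw [hmap, Finset.map_val, Multiset.map_map, ← Subgroup.orderOf_mk x hx, ← h.map_hangingTree hn]
  simp only [Function.comp_def, Function.Embedding.subtype_apply, Subgroup.orderOf_coe]

theorem exists_enumeration {V β : Type*} {s : Finset V} {c : V → β} {l : List β}
    (h : s.val.map c = (l : Multiset β)) :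
    ∃ k : Fin l.length → V, Function.Injective k ∧ Set.range k = s ∧ ∀ j, c (k j) = l.get j := by
  obtain ⟨L, hL, rfl⟩ : ∃ L : List V, (L : Multiset V) = s.val ∧ L.map c = l := by
    have hperm : l.Perm (s.toList.map c) := by
      rw [← Multiset.coe_eq_coe, ← h, ← Multiset.map_coe, Finset.coe_toList]
    obtain ⟨L, hL, hperm⟩ : Relation.Comp (· = List.map c ·) List.Perm l s.toList := by
      rwa [List.eq_map_comp_perm]
    exact ⟨L, by rw [← Finset.coe_toList, Multiset.coe_eq_coe]; exact hperm, hL.symm⟩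
  have hnodup : L.Nodup := by
    rw [← Multiset.coe_nodup, hL]
    exact s.nodup
  refine ⟨L.get ∘ Fin.cast (by simp), ?_, ?_, fun j => by simp⟩
  · exact (List.nodup_iff_injective_get.1 hnodup).comp (Fin.cast_injective _)
  · have hcast : Function.Surjective (Fin.cast (List.length_map c : (L.map c).length = L.length)) :=
      (finCongr (List.length_map c)).surjective
    rw [hcast.range_comp, Set.range_list_get]
    ext y
    rw [Set.mem_ofPred_eq, Finset.mem_coe, ← Finset.mem_val, ← hL, Multiset.mem_coe]

/-! ### Groups partitioned by cyclic subgroups -/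

theorem ord_pos {d t : ℕ} (hd : 0 < d) (h : Nat.Coprime t d) : 0 < ord d t := by
  have : NeZero d := ⟨hd.ne'⟩
  rw [ord, ← ZMod.coe_unitOfCoprime t h, orderOf_units]
  exact orderOf_pos _

theorem minimalPeriod_pow {G : Type*} [Group G] (t : ℕ) (x : G) :
    Function.minimalPeriod (fun g : G => g ^ t) x = ord (orderOf x) t := by
  have hiff : ∀ j, Function.minimalPeriod (fun g : G => g ^ t) x ∣ j ↔ ord (orderOf x) t ∣ j := by
    intro j
    rw [← Function.isPeriodicPt_iff_minimalPeriod_dvd, Function.IsPeriodicPt, Function.IsFixedPt,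
      pow_iterate, ord, orderOf_dvd_iff_pow_eq_one, ← Nat.cast_pow, ← Nat.cast_one,
      ZMod.natCast_eq_natCast_iff, ← pow_eq_pow_iff_modEq, pow_one]
  exact Nat.dvd_antisymm ((hiff _).2 dvd_rfl) ((hiff _).1 dvd_rfl)

theorem orderOf_iterate_pow_dvd {G : Type*} [Monoid G] (t : ℕ) {n : ℕ} {y : G}
    (hy : orderOf y ∣ n) (j : ℕ) :
    orderOf ((fun g : G => g ^ t)^[j] y) ∣ (powImageCard t)^[j] n := by
  induction j with
  | zero => exact hy
  | succ j ih =>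
    rw [Function.iterate_succ_apply', Function.iterate_succ_apply']
    exact orderOf_pow_dvd_powImageCard t ih

theorem IsKernelSeq.forest_elementary_eq_nil {t ω : ℕ} {v : List ℕ} (h : IsKernelSeq t 1 ω v) :
    (RTree.elementary v).forest = [] := by
  have himage : ∀ i, (powImageCard t)^[i] 1 = 1 := fun i =>
    Nat.dvd_one.1 (iterate_powImageCard_dvd t 1 i)
  have hforest := h.coe_forest_hangingTree dvd_rfl
  rw [hangingTree, if_pos (one_dvd ω)] at hforest
  rw [← Multiset.coe_eq_zero, hforest]
  refine Finset.sum_eq_zero fun i _ => ?_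
  simp only [rootCount, himage, dvd_refl, if_true, Nat.gcd_one_right, Nat.sub_self,
    Multiset.replicate_zero]

/-- Every nontrivial element of `G` lies in exactly one of the subgroups `H i`, which are cyclic;
they are sorted into types by `τ`, the subgroups of type `k` having order `n k`. -/
structure IsCyclicPartition {G ι κ : Type*} [Group G] (H : ι → Subgroup G) (τ : ι → κ)
    (n : κ → ℕ) : Prop where
  isCyclic : ∀ i, IsCyclic (H i)
  natCard_eq : ∀ i, Nat.card (H i) = n (τ i)
  exists_mem : ∀ g, g ≠ 1 → ∃ i, g ∈ H i
  eq_of_mem : ∀ g, g ≠ 1 → ∀ i j, g ∈ H i → g ∈ H j → i = j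

/-- The elements `g` such that `orderOf g ∣ ω (τ i)` for every part `H i` containing `g`: if the
`t`-th power map is bijective exactly on the subgroup of order `ω k` in the parts of type `k`, these
are the periodic elements. -/
def periodicSet {G ι κ : Type*} [Group G] (H : ι → Subgroup G) (τ : ι → κ) (ω : κ → ℕ) : Set G :=
  {g | ∀ i, g ∈ H i → orderOf g ∣ ω (τ i)}

/-- The vertices of the cycles in the families `cycleFamily (m k) (ω k) t _`. -/
abbrev CycleVertex {κ : Type*} (m ω : κ → ℕ) (t : ℕ) : Type _ :=
  Σ k, Σ d : {d : ℕ // d ∣ ω k ∧ d ≠ 1},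
    Σ _ : Fin (m k * Nat.totient d / ord d t), ZMod (ord d t)

/-- The successor map on the vertices of the cycles. -/
noncomputable def cycleShift {κ : Type*} (m ω : κ → ℕ) (t : ℕ) (z : CycleVertex m ω t) :
    CycleVertex m ω t :=
  ⟨z.1, z.2.1, z.2.2.1, z.2.2.2 + 1⟩

theorem cycleFamily_eq_functionalGraph (c ω t : ℕ) (T : RTree) :
    cycleFamily c ω t T = functionalGraph (Sigma.map id fun d : {d : ℕ // d ∣ ω ∧ d ≠ 1} =>
      Sigma.map id fun _ : Fin (c * Nat.totient d / ord d t) => cycMap (ord d t) T) := by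
  simp only [cycleFamily, copies, Cyc_eq_functionalGraph, disjUnion_functionalGraph]

theorem one_mem_periodicSet {G ι κ : Type*} [Group G] (H : ι → Subgroup G) (τ : ι → κ)
    (ω : κ → ℕ) : 1 ∈ periodicSet H τ ω := by
  intro i _
  rw [orderOf_one]
  exact one_dvd _

theorem notMem_periodicSet_iff {G ι κ : Type*} [Group G] {H : ι → Subgroup G} {τ : ι → κ}
    {ω : κ → ℕ} {g : G} : g ∉ periodicSet H τ ω ↔ ∃ i, g ∈ H i ∧ ¬ orderOf g ∣ ω (τ i) := by
  simp only [periodicSet, Set.mem_ofPred_eq, not_forall, exists_prop]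

namespace IsCyclicPartition

variable {G ι κ : Type*} [Group G] {H : ι → Subgroup G} {τ : ι → κ} {n : κ → ℕ}

theorem orderOf_dvd (hP : IsCyclicPartition H τ n) {i : ι} {g : G} (hg : g ∈ H i) :
    orderOf g ∣ n (τ i) := by
  rw [← hP.natCard_eq, ← Subgroup.orderOf_mk g hg]
  exact orderOf_dvd_natCard _

theorem mem_periodicSet_iff (hP : IsCyclicPartition H τ n) {ω : κ → ℕ} {g : G} (hg : g ≠ 1) {i : ι}
    (hi : g ∈ H i) : g ∈ periodicSet H τ ω ↔ orderOf g ∣ ω (τ i) := by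
  refine ⟨fun h => h i hi, fun h j hj => ?_⟩
  rwa [hP.eq_of_mem g hg j i hj hi]

theorem natCard_mem_and [Finite G] [Finite ι] (hP : IsCyclicPartition H τ n) {k : κ}
    {P : G → Prop} (hP1 : ¬ P 1) {c : ℕ} (hc : ∀ i, τ i = k → Nat.card {g : H i // P g} = c) :
    Nat.card {g : G // ∃ i, τ i = k ∧ g ∈ H i ∧ P g} = Nat.card {i // τ i = k} * c := by
  classical
  have := Fintype.ofFinite ι
  have hbij : Function.Bijective fun a : (Σ i : {i // τ i = k}, {g : H i // P g}) =>
      (⟨a.2.1.1, a.1, a.1.2, a.2.1.2, a.2.2⟩ : {g : G // ∃ i, τ i = k ∧ g ∈ H i ∧ P g}) := by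
    constructor
    · rintro ⟨⟨i, hi⟩, ⟨g, hg⟩, hgP⟩ ⟨⟨j, hj⟩, ⟨g', hg'⟩, hgP'⟩ hgg
      obtain rfl : g = g' := congrArg Subtype.val hgg
      obtain rfl := hP.eq_of_mem g (fun h => hP1 (h ▸ hgP)) i j hg hg'
      rfl
    · rintro ⟨g, i, hi, hg, hgP⟩
      exact ⟨⟨⟨i, hi⟩, ⟨g, hg⟩, hgP⟩, rfl⟩
  rw [← Nat.card_congr (Equiv.ofBijective _ hbij), Nat.card_sigma,
    Finset.sum_congr rfl fun i _ => hc i.1 i.2, Finset.sum_const, Finset.card_univ, smul_eq_mul,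
    ← Nat.card_eq_fintype_card]

theorem natCard_orderOf_eq [Finite G] [Finite ι] (hP : IsCyclicPartition H τ n) {k : κ} {d : ℕ}
    (hd : d ∣ n k) (hd1 : d ≠ 1) :
    Nat.card {g : G // ∃ i, τ i = k ∧ g ∈ H i ∧ orderOf g = d} =
      Nat.card {i // τ i = k} * Nat.totient d := by
  classical
  have := Fintype.ofFinite G
  refine hP.natCard_mem_and (by rwa [orderOf_one, eq_comm]) fun i hi => ?_
  have := hP.isCyclic i
  simp only [Subgroup.orderOf_coe]
  rw [Nat.card_eq_fintype_card, Fintype.card_subtype]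
  exact IsCyclic.card_orderOf_eq_totient (by rwa [← Nat.card_eq_fintype_card, hP.natCard_eq, hi])

theorem natCard_ne_one [Finite G] [Finite ι] (hP : IsCyclicPartition H τ n) (k : κ) :
    Nat.card {g : G // ∃ i, τ i = k ∧ g ∈ H i ∧ g ≠ 1} =
      Nat.card {i // τ i = k} * (n k - 1) := by
  classical
  have := Fintype.ofFinite G
  refine hP.natCard_mem_and (not_not.2 rfl) fun i hi => ?_
  simp only [Ne, OneMemClass.coe_eq_one]
  rw [Nat.card_eq_fintype_card, Fintype.card_subtype_compl, Fintype.card_subtype_eq,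
    ← Nat.card_eq_fintype_card, hP.natCard_eq, hi]

theorem natCard_eq_sum_add_one [Finite G] [Finite ι] [Fintype κ] (hP : IsCyclicPartition H τ n) :
    Nat.card G = ∑ k, Nat.card {i // τ i = k} * (n k - 1) + 1 := by
  classical
  have := Fintype.ofFinite G
  have hbij : Function.Bijective
      fun a : (Σ k, {g : G // ∃ i, τ i = k ∧ g ∈ H i ∧ g ≠ 1}) =>
        (⟨a.2.1, a.2.2.choose_spec.2.2⟩ : {g : G // g ≠ 1}) := by
    constructor
    · rintro ⟨_, g, i, rfl, hi, hg⟩ ⟨_, g', j, rfl, hj, hg'⟩ hgg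
      obtain rfl : g = g' := congrArg Subtype.val hgg
      obtain rfl := hP.eq_of_mem g hg i j hi hj
      rfl
    · rintro ⟨g, hg⟩
      obtain ⟨i, hi⟩ := hP.exists_mem g hg
      exact ⟨⟨τ i, g, i, rfl, hi, hg⟩, rfl⟩
  rw [← Finset.sum_congr rfl fun k _ => hP.natCard_ne_one k, ← Nat.card_sigma,
    Nat.card_congr (Equiv.ofBijective _ hbij), Nat.card_eq_fintype_card, Nat.card_eq_fintype_card,
    Fintype.card_subtype_compl, Fintype.card_subtype_eq, Nat.sub_add_cancel Fintype.card_pos]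

theorem exists_equiv_orderOf_eq [Finite G] [Finite ι] (hP : IsCyclicPartition H τ n) {k : κ}
    {m d t : ℕ} (hm : Nat.card {i // τ i = k} = m) (hd : d ∣ n k) (hd1 : d ≠ 1) (hd0 : 0 < d)
    (hdt : Nat.Coprime t d) :
    ∃ e : (Σ _ : Fin (m * Nat.totient d / ord d t), ZMod (ord d t)) ≃
        {g : G // ∃ i, τ i = k ∧ g ∈ H i ∧ orderOf g = d},
      ∀ j z, (e ⟨j, z + 1⟩ : G) = (e ⟨j, z⟩ : G) ^ t := by
  have hmap : ∀ g : G, (∃ i, τ i = k ∧ g ∈ H i ∧ orderOf g = d) →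
      ∃ i, τ i = k ∧ g ^ t ∈ H i ∧ orderOf (g ^ t) = d := by
    rintro g ⟨i, hi, hg, rfl⟩
    exact ⟨i, hi, pow_mem hg t, hdt.symm.orderOf_pow⟩
  have hperiod : ∀ g,
      Function.minimalPeriod (Subtype.map (fun g : G => g ^ t) hmap) g = ord d t := by
    rintro ⟨g, hg⟩
    have hval : Function.Semiconj Subtype.val (Subtype.map (fun g : G => g ^ t) hmap)
      (fun g => g ^ t) := fun _ => rfl
    trans Function.minimalPeriod (fun g : G => g ^ t) g
    · rw [Function.minimalPeriod_eq_minimalPeriod_iff]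
      intro j
      rw [Function.IsPeriodicPt, Function.IsFixedPt, Subtype.ext_iff, (hval.iterate_right j).eq]
      rfl
    · rw [minimalPeriod_pow, hg.choose_spec.2.2]
  rw [← hm, ← hP.natCard_orderOf_eq hd hd1]
  obtain ⟨e, he⟩ := exists_equiv_sigma_zmod (ord_pos hd0 hdt) hperiod
  exact ⟨e, fun j z => congrArg Subtype.val (he j z)⟩

variable {m ω : κ → ℕ} {t : ℕ} {v : κ → List ℕ}

theorem exists_cycleVertex_param [Finite G] [Finite ι] (hP : IsCyclicPartition H τ n)
    (hm : ∀ k, n k ≠ 1 → Nat.card {i // τ i = k} = m k)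
    (hv : ∀ k, IsKernelSeq t (n k) (ω k) (v k)) :
    ∃ a : CycleVertex m ω t → G, Function.Injective a ∧
      Function.Semiconj a (cycleShift m ω t) (fun g => g ^ t) ∧
      (∀ z, ∃ i, τ i = z.1 ∧ a z ∈ H i ∧ orderOf (a z) = z.2.1) ∧
      Set.range a = periodicSet H τ ω \ {1} := by
  have hparam : ∀ (k : κ) (d : {d : ℕ // d ∣ ω k ∧ d ≠ 1}), _ := fun k d =>
    have hd : d.1 ∣ n k := d.2.1.trans (hv k).dvd
    hP.exists_equiv_orderOf_eq
      (hm k fun hnk => d.2.2 (Nat.dvd_one.1 (hd.trans hnk.dvd))) hd d.2.2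
      (Nat.pos_of_dvd_of_pos hd (hv k).pos) ((hv k).coprime.coprime_dvd_right d.2.1)
  choose e he using hparam
  have hne : ∀ k d z, (e k d z : G) ≠ 1 := by
    intro k d z h1
    have ho := (e k d z).2.choose_spec.2.2
    rw [h1, orderOf_one] at ho
    exact d.2.2 ho.symm
  refine ⟨fun z => e z.1 z.2.1 z.2.2, ?_, fun z => he z.1 z.2.1 z.2.2.1 z.2.2.2,
    fun z => (e z.1 z.2.1 z.2.2).2, ?_⟩
  · rintro ⟨k, d, z⟩ ⟨k', d', z'⟩ (h : (e k d z : G) = e k' d' z')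
    obtain ⟨i, rfl, hi, ho⟩ := (e k d z).2
    obtain ⟨j, rfl, hj, ho'⟩ := (e k' d' z').2
    obtain rfl := hP.eq_of_mem _ (hne _ d z) i j hi (h ▸ hj)
    obtain rfl : d = d' := Subtype.ext (by rw [← ho, ← ho', h])
    rw [(e _ d).injective (Subtype.ext h)]
  · ext g
    constructor
    · rintro ⟨⟨k, d, z⟩, rfl⟩
      obtain ⟨i, rfl, hi, ho⟩ := (e k d z).2
      exact ⟨(hP.mem_periodicSet_iff (hne _ d z) hi).2 (ho.dvd.trans d.2.1), hne _ d z⟩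
    · rintro ⟨hg, hg1⟩
      obtain ⟨i, hi⟩ := hP.exists_mem g hg1
      refine ⟨⟨τ i, ⟨orderOf g, hg i hi, mt orderOf_eq_one_iff.1 hg1⟩,
        (e (τ i) _).symm ⟨g, i, rfl, hi, rfl⟩⟩, ?_⟩
      simp only [Equiv.apply_symm_apply]

/-- The tree hanging at `g` in the graph of the `t`-th power map: a prescribed tree `S` at `1`, and
the tree given by the cyclic group containing `g` otherwise. -/
noncomputable def treeAt (hP : IsCyclicPartition H τ n) (ω : κ → ℕ) (v : κ → List ℕ) (t : ℕ)
    (S : RTree) (g : G) : RTree :=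
  open Classical in
  if hg : g = 1 then S
  else
    let k := τ (hP.exists_mem g hg).choose
    hangingTree t (n k) (ω k) (v k) (orderOf g)

theorem treeAt_one (hP : IsCyclicPartition H τ n) (S : RTree) : hP.treeAt ω v t S 1 = S :=
  dif_pos rfl

theorem treeAt_of_mem (hP : IsCyclicPartition H τ n) (S : RTree) {g : G} (hg : g ≠ 1) {i : ι}
    (hi : g ∈ H i) :
    hP.treeAt ω v t S g = hangingTree t (n (τ i)) (ω (τ i)) (v (τ i)) (orderOf g) := by
  rw [treeAt, dif_neg hg, hP.eq_of_mem g hg _ _ (hP.exists_mem g hg).choose_spec hi]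

section Fibers

variable [Fintype G]

open Classical in
theorem map_treeAt_part (hP : IsCyclicPartition H τ n)
    (hv : ∀ k, IsKernelSeq t (n k) (ω k) (v k)) (S : RTree) {i : ι} {x : G} (hi : x ∈ H i) :
    (Finset.univ.filter fun y : G => y ∈ H i ∧ y ^ t = x ∧ ¬ orderOf y ∣ ω (τ i)).val.map
        (hP.treeAt ω v t S) =
      ((hangingTree t (n (τ i)) (ω (τ i)) (v (τ i)) (orderOf x)).forest : Multiset RTree) := by
  have := hP.isCyclic i
  rw [← (hv (τ i)).map_hangingTree_subgroup (H i) (hP.natCard_eq i) hi]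
  refine Multiset.map_congr rfl fun y hy => ?_
  obtain ⟨hyi, -, hyω⟩ := (Finset.mem_filter.1 hy).2
  refine hP.treeAt_of_mem S ?_ hyi
  rintro rfl
  exact hyω (orderOf_one (G := G) ▸ one_dvd _)

open Classical in
theorem map_treeAt_of_ne_one (hP : IsCyclicPartition H τ n)
    (hv : ∀ k, IsKernelSeq t (n k) (ω k) (v k)) (S : RTree) {x : G} (hx : x ≠ 1) :
    (Finset.univ.filter fun y : G => y ^ t = x ∧ y ∉ periodicSet H τ ω).val.map
        (hP.treeAt ω v t S) = ((hP.treeAt ω v t S x).forest : Multiset RTree) := by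
  obtain ⟨i, hi⟩ := hP.exists_mem x hx
  rw [hP.treeAt_of_mem S hx hi, ← hP.map_treeAt_part hv S hi]
  congr 2
  ext y
  simp only [Finset.mem_filter, Finset.mem_univ, true_and, notMem_periodicSet_iff]
  constructor
  · rintro ⟨hyx, j, hj, hjω⟩
    obtain rfl := hP.eq_of_mem x hx i j hi (hyx ▸ pow_mem hj t)
    exact ⟨hj, hyx, hjω⟩
  · rintro ⟨hyi, hyx, hyω⟩
    exact ⟨hyx, i, hyi, hyω⟩

open Classical in
theorem filter_pow_eq_one_notMem_periodicSet [Fintype ι] (hP : IsCyclicPartition H τ n) :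
    (Finset.univ.filter fun y : G => y ^ t = 1 ∧ y ∉ periodicSet H τ ω).val =
      ∑ i, (Finset.univ.filter fun y : G =>
        y ∈ H i ∧ y ^ t = 1 ∧ ¬ orderOf y ∣ ω (τ i)).val := by
  have hdisjoint : ((Finset.univ : Finset ι) : Set ι).PairwiseDisjoint fun i =>
      Finset.univ.filter fun y : G => y ∈ H i ∧ y ^ t = 1 ∧ ¬ orderOf y ∣ ω (τ i) := by
    intro i _ j _ hij
    rw [Function.onFun, Finset.disjoint_left]
    intro y hy hy'
    obtain ⟨hyi, -, hyω⟩ := (Finset.mem_filter.1 hy).2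
    refine hij (hP.eq_of_mem y ?_ i j hyi (Finset.mem_filter.1 hy').2.1)
    rintro rfl
    exact hyω (orderOf_one (G := G) ▸ one_dvd _)
  change _ = (Finset.univ.disjiUnion _ hdisjoint).val
  congr 1
  ext y
  simp only [Finset.mem_filter, Finset.mem_univ, true_and, Finset.mem_disjiUnion,
    notMem_periodicSet_iff]
  grind

open Classical in
theorem map_treeAt_one [Finite ι] [Fintype κ] (hP : IsCyclicPartition H τ n)
    (hm : ∀ k, n k ≠ 1 → Nat.card {i // τ i = k} = m k)
    (hv : ∀ k, IsKernelSeq t (n k) (ω k) (v k)) {S : RTree}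
    (hS : (S.forest : Multiset RTree) =
      ∑ k, m k • ((RTree.elementary (v k)).forest : Multiset RTree)) :
    (Finset.univ.filter fun y : G => y ^ t = 1 ∧ y ∉ periodicSet H τ ω).val.map
        (hP.treeAt ω v t S) = (S.forest : Multiset RTree) := by
  have := Fintype.ofFinite ι
  have hpart : ∀ i, (Finset.univ.filter fun y : G =>
      y ∈ H i ∧ y ^ t = 1 ∧ ¬ orderOf y ∣ ω (τ i)).val.map (hP.treeAt ω v t S) =
        ((RTree.elementary (v (τ i))).forest : Multiset RTree) := by
    intro i
    rw [hP.map_treeAt_part hv S (one_mem (H i)), orderOf_one, hangingTree, if_pos (one_dvd _)]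
  rw [hP.filter_pow_eq_one_notMem_periodicSet, ← Multiset.coe_mapAddMonoidHom, map_sum, hS]
  simp only [Multiset.coe_mapAddMonoidHom, hpart]
  rw [← Finset.sum_fiberwise Finset.univ τ]
  refine Finset.sum_congr rfl fun k _ => ?_
  rw [Finset.sum_congr rfl fun i hi => by rw [(Finset.mem_filter.1 hi).2], Finset.sum_const]
  by_cases hnk : n k = 1
  · rw [IsKernelSeq.forest_elementary_eq_nil (hnk ▸ hv k), Multiset.coe_nil, smul_zero, smul_zero]
  · rw [← hm k hnk, Nat.card_eq_fintype_card, Fintype.card_subtype]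

end Fibers

theorem exists_iterate_pow_mem_periodicSet (hP : IsCyclicPartition H τ n)
    (hv : ∀ k, IsKernelSeq t (n k) (ω k) (v k)) (x : G) :
    ∃ j, (fun g : G => g ^ t)^[j] x ∈ periodicSet H τ ω := by
  by_cases hx : x = 1
  · exact ⟨0, hx ▸ one_mem_periodicSet H τ ω⟩
  · obtain ⟨i, hi⟩ := hP.exists_mem x hx
    refine ⟨(v (τ i)).length, ?_⟩
    have hdvd := orderOf_iterate_pow_dvd t (hP.orderOf_dvd hi) (v (τ i)).length
    rw [(hv (τ i)).iterate_eq] at hdvd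
    by_cases hx1 : (fun g : G => g ^ t)^[(v (τ i)).length] x = 1
    · exact hx1 ▸ one_mem_periodicSet H τ ω
    · refine (hP.mem_periodicSet_iff hx1 ?_).2 hdvd
      rw [pow_iterate]
      exact pow_mem hi _

theorem isDecorated_pow [Finite G] [Finite ι] [Fintype κ] (hP : IsCyclicPartition H τ n)
    (hm : ∀ k, n k ≠ 1 → Nat.card {i // τ i = k} = m k)
    (hv : ∀ k, IsKernelSeq t (n k) (ω k) (v k)) {S : RTree}
    (hS : (S.forest : Multiset RTree) =
      ∑ k, m k • ((RTree.elementary (v k)).forest : Multiset RTree))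
    {a : CycleVertex m ω t → G} (ha : Function.Injective a)
    (hshift : Function.Semiconj a (cycleShift m ω t) (fun g => g ^ t))
    (hrange : Set.range a = periodicSet H τ ω \ {1}) :
    IsDecorated (fun g : G => g ^ t) (Sum.elim a fun _ : ZMod 1 => 1)
      (Sum.map (cycleShift m ω t) fun z => z + 1) (hP.treeAt ω v t S) := by
  classical
  have := Fintype.ofFinite G
  have hne : ∀ z, a z ≠ 1 := fun z => (hrange.le (Set.mem_range_self z)).2
  have hperiodic : Set.range (Sum.elim a fun _ : ZMod 1 => 1) = periodicSet H τ ω := by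
    rw [Set.Sum.elim_range, hrange, Set.range_const, Set.sdiff_union_of_subset]
    exact Set.singleton_subset_iff.2 (one_mem_periodicSet H τ ω)
  refine ⟨ha.sumElim (fun _ _ _ => Subsingleton.elim _ _) fun z _ => hne z, ?_, fun x => ?_,
    fun x => ?_⟩
  · rintro (z | _)
    · exact hshift z
    · exact (one_pow t).symm
  · rw [hperiodic]
    exact hP.exists_iterate_pow_mem_periodicSet hv x
  · have hmap : (Finset.univ.filter fun y : G => y ^ t = x ∧ y ∉ periodicSet H τ ω).val.map
        (hP.treeAt ω v t S) = ((hP.treeAt ω v t S x).forest : Multiset RTree) := by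
      by_cases hx : x = 1
      · rw [hx, hP.treeAt_one, hP.map_treeAt_one hm hv hS]
      · exact hP.map_treeAt_of_ne_one hv S hx
    simpa only [hperiodic, Finset.coe_filter, Finset.mem_univ, true_and]
      using exists_enumeration hmap

theorem isomorphic_pow [Finite G] [Finite ι] [Fintype κ] (hP : IsCyclicPartition H τ n)
    (hm : ∀ k, n k ≠ 1 → Nat.card {i // τ i = k} = m k)
    (hv : ∀ k, IsKernelSeq t (n k) (ω k) (v k)) {S : RTree}
    (hS : (S.forest : Multiset RTree) =
      ∑ k, m k • ((RTree.elementary (v k)).forest : Multiset RTree)) :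
    Isomorphic (functionalGraph fun g : G => g ^ t)
      (disjSum (disjUnion fun k => cycleFamily (m k) (ω k) t (RTree.elementary (v k)))
        (Cyc 1 S)) := by
  obtain ⟨a, ha, hshift, hmem, hrange⟩ := hP.exists_cycleVertex_param hm hv
  simp only [cycleFamily_eq_functionalGraph, Cyc_eq_functionalGraph, disjUnion_functionalGraph,
    disjSum_functionalGraph]
  refine (hP.isDecorated_pow hm hv hS ha hshift hrange).isomorphic
    (IsDecorated.sumMap (IsDecorated.sigmaMap fun k => IsDecorated.sigmaMap fun d =>
      IsDecorated.sigmaMap fun _ => isDecorated_cycMap _ _) (isDecorated_cycMap 1 S)) ?_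
  rintro (z | z)
  · obtain ⟨i, hi, hai, ho⟩ := hmem z
    have hne : a z ≠ 1 := (hrange.le (Set.mem_range_self z)).2
    change hP.treeAt ω v t S (a z) = RTree.subtree (RTree.root (RTree.elementary (v z.1)))
    rw [RTree.subtree_root, hP.treeAt_of_mem S hne hai, hi, hangingTree, if_pos]
    exact ho.dvd.trans z.2.1.2.1
  · change hP.treeAt ω v t S 1 = RTree.subtree (RTree.root S)
    rw [RTree.subtree_root, hP.treeAt_one]

end IsCyclicPartition

/-! ### Matrices of size two -/

open Matrix

section Matrices

variable {F : Type*} [Field F]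

/-- Scalar matrices, which are the representatives of the identity of `PGL(2, F)`. -/
def IsScalar (A : Matrix (Fin 2) (Fin 2) F) : Prop :=
  ∃ u : F, A = u • 1

/-- The singular matrices of trace `s`: the idempotents of rank one if `s = 1`, and the nilpotent
matrices if `s = 0`. -/
abbrev SingularMatrix (F : Type*) [Field F] (s : F) :=
  {A : Matrix (Fin 2) (Fin 2) F // A.trace = s ∧ A.det = 0}

theorem mul_self_eq_smul_one_add_smul (A : Matrix (Fin 2) (Fin 2) F) :
    A * A = (-A.det) • 1 + A.trace • A := by
  have h := aeval_self_charpoly A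
  rw [charpoly_fin_two] at h
  simp only [map_add, map_sub, map_mul, map_pow, Polynomial.aeval_X, Polynomial.aeval_C,
    Algebra.algebraMap_eq_smul_one, smul_mul_assoc, one_mul] at h
  rw [← sub_eq_zero, ← h, pow_two]
  module

theorem trace_smul_add_smul_one (x y : F) (A : Matrix (Fin 2) (Fin 2) F) :
    (x • A + y • 1).trace = x * A.trace + 2 * y := by
  simp only [trace_add, trace_smul, trace_one, Fintype.card_fin, Nat.cast_ofNat, smul_eq_mul]
  ring

theorem det_smul_add_smul_one (x y : F) (A : Matrix (Fin 2) (Fin 2) F) :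
    (x • A + y • 1).det = x ^ 2 * A.det + x * y * A.trace + y ^ 2 := by
  simp only [det_fin_two, trace_fin_two, Matrix.add_apply, Matrix.smul_apply, smul_eq_mul,
    one_apply_eq, mul_one, one_apply_ne, mul_zero, add_zero, ne_eq, one_ne_zero, zero_ne_one,
    not_false_eq_true]
  ring

theorem isScalar_of_smul_add_smul_one_eq {A : Matrix (Fin 2) (Fin 2) F} {x y z : F} (hx : x ≠ 0)
    (h : x • A + y • 1 = z • 1) : IsScalar A :=
  ⟨x⁻¹ * (z - y), by rw [mul_smul, sub_smul, ← h, add_sub_cancel_right, inv_smul_smul₀ hx]⟩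

theorem eq_smul_one_add_smul_of_commute {A B : Matrix (Fin 2) (Fin 2) F} (hA : ¬ IsScalar A)
    (h : Commute B A) : ∃ a b : F, B = a • 1 + b • A := by
  -- Commuting means that the coordinates modulo scalars have a vanishing cross product.
  let v (C : Matrix (Fin 2) (Fin 2) F) : Fin 3 → F := ![C 0 1, C 1 0, C 0 0 - C 1 1]
  have scalar_of_entries (C : Matrix (Fin 2) (Fin 2) F) (h₀₁ : C 0 1 = 0) (h₁₀ : C 1 0 = 0)
      (h : C 0 0 = C 1 1) : C = C 0 0 • 1 := by
    ext i j
    fin_cases i <;> fin_cases j <;> simp [h₀₁, h₁₀, h]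
  have hv : v A ≠ 0 := fun h0 => hA ⟨A 0 0, scalar_of_entries A (congrFun h0 0) (congrFun h0 1)
    (sub_eq_zero.1 (congrFun h0 2))⟩
  have hcross : crossProduct (v A) (v B) = 0 := by
    have h00 := congrFun (congrFun h 0) 0
    have h01 := congrFun (congrFun h 0) 1
    have h10 := congrFun (congrFun h 1) 0
    simp only [Matrix.mul_apply, Fin.sum_univ_two] at h00 h01 h10
    rw [cross_apply]
    ext i
    fin_cases i <;>
      simp only [v, Matrix.cons_val, Matrix.cons_val_zero, Fin.zero_eta, Fin.mk_one,
        Fin.reduceFinMk, Matrix.cons_val_one, Pi.zero_apply] <;>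
      grind
  have hdep := (not_congr crossProduct_ne_zero_iff_linearIndependent).1 (not_not.2 hcross)
  rw [LinearIndependent.pair_iff' hv] at hdep
  push Not at hdep
  obtain ⟨b, hb⟩ := hdep
  have h₂ : b * (A 0 0 - A 1 1) = B 0 0 - B 1 1 := congrFun hb 2
  refine ⟨(B - b • A) 0 0, b, ?_⟩
  rw [← scalar_of_entries (B - b • A), sub_add_cancel]
  · exact sub_eq_zero.2 (congrFun hb 0).symm
  · exact sub_eq_zero.2 (congrFun hb 1).symm
  · simp only [Matrix.sub_apply, Matrix.smul_apply, smul_eq_mul]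
    linear_combination -h₂

end Matrices

/-! ### Tori of `PGL(2, F)` -/

section Torus

variable {F : Type*} [Field F]

theorem mk_eq_mk_iff_smul {g h : GL (Fin 2) F} :
    ProjGenLinGroup.mk g = ProjGenLinGroup.mk h ↔ ∃ u : F, h.1 = u • g.1 := by
  have mul_scalar (u : Fˣ) : (g * GeneralLinearGroup.scalar (Fin 2) u).1 = u.1 • g.1 := by
    rw [Units.val_mul, GeneralLinearGroup.coe_scalar, Matrix.scalar_apply,
      ← Matrix.smul_one_eq_diagonal, Matrix.mul_smul, Matrix.mul_one]
  rw [ProjGenLinGroup.mk_eq_mk_iff]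
  constructor
  · rintro ⟨u, rfl⟩
    exact ⟨u, mul_scalar u⟩
  · rintro ⟨u, hu⟩
    have hu0 : u ≠ 0 := by
      rintro rfl
      exact h.ne_zero (hu.trans (zero_smul F g.1))
    exact ⟨Units.mk0 u hu0, Units.ext ((mul_scalar _).trans hu.symm)⟩

theorem mk_eq_one_iff_isScalar {g : GL (Fin 2) F} : ProjGenLinGroup.mk g = 1 ↔ IsScalar g.1 := by
  rw [eq_comm, ← map_one ProjGenLinGroup.mk, mk_eq_mk_iff_smul]
  rfl

theorem commute_of_mk_eq_mk {g g' : GL (Fin 2) F} {A : Matrix (Fin 2) (Fin 2) F}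
    (h : ProjGenLinGroup.mk g = ProjGenLinGroup.mk g') (hA : Commute A g.1) : Commute A g'.1 := by
  obtain ⟨u, hu⟩ := mk_eq_mk_iff_smul.1 h
  exact hu ▸ hA.smul_right u

/-- The image in `PGL(2, F)` of the centralizer of a representative of `x`. It is usually smaller
than the centralizer of `x`. -/
noncomputable def torus (x : PGL(2, F)) : Subgroup PGL(2, F) :=
  (Subgroup.centralizer {Function.surjInv ProjGenLinGroup.mk_surjective x}).map ProjGenLinGroup.mk

theorem mk_mem_torus_mk {g h : GL (Fin 2) F} :
    ProjGenLinGroup.mk h ∈ torus (ProjGenLinGroup.mk g) ↔ Commute h.1 g.1 := by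
  have hg' := Function.surjInv_eq ProjGenLinGroup.mk_surjective (ProjGenLinGroup.mk g)
  simp only [torus, Subgroup.mem_map, Subgroup.mem_centralizer_singleton_iff]
  constructor
  · rintro ⟨k, hk, hkh⟩
    exact (commute_of_mk_eq_mk hkh (commute_of_mk_eq_mk hg' (congrArg Units.val hk)).symm).symm
  · exact fun hh => ⟨h, Units.ext (commute_of_mk_eq_mk hg'.symm hh), rfl⟩

theorem mem_torus_comm {x y : PGL(2, F)} : x ∈ torus y ↔ y ∈ torus x := by
  obtain ⟨g, rfl⟩ := ProjGenLinGroup.mk_surjective x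
  obtain ⟨h, rfl⟩ := ProjGenLinGroup.mk_surjective y
  rw [mk_mem_torus_mk, mk_mem_torus_mk]
  exact Commute.symm_iff

theorem mem_torus_self (x : PGL(2, F)) : x ∈ torus x := by
  obtain ⟨g, rfl⟩ := ProjGenLinGroup.mk_surjective x
  exact mk_mem_torus_mk.2 (Commute.refl _)

theorem mem_torus_trans {x y z : PGL(2, F)} (hy : y ≠ 1) (hxy : x ∈ torus y) (hyz : y ∈ torus z) :
    x ∈ torus z := by
  obtain ⟨g, rfl⟩ := ProjGenLinGroup.mk_surjective x
  obtain ⟨h, rfl⟩ := ProjGenLinGroup.mk_surjective y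
  obtain ⟨k, rfl⟩ := ProjGenLinGroup.mk_surjective z
  rw [Ne, mk_eq_one_iff_isScalar] at hy
  rw [mk_mem_torus_mk] at hxy hyz ⊢
  obtain ⟨a, b, hab⟩ := eq_smul_one_add_smul_of_commute hy hxy
  rw [hab]
  exact ((Commute.one_left k.1).smul_left a).add_left (hyz.smul_left b)

theorem torus_eq_of_mem {x y : PGL(2, F)} (hx : x ≠ 1) (hy : y ≠ 1) (h : y ∈ torus x) :
    torus y = torus x :=
  Subgroup.ext fun _ => ⟨fun hz => mem_torus_trans hy hz h,
    fun hz => mem_torus_trans hx hz (mem_torus_comm.1 h)⟩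

end Torus

section SingularMatrices

variable {F : Type*} [Field F] {s : F}

theorem SingularMatrix.mul_self (A : SingularMatrix F s) : A.1 * A.1 = s • A.1 := by
  rw [mul_self_eq_smul_one_add_smul, A.2.1, A.2.2, neg_zero, zero_smul, zero_add]

theorem SingularMatrix.eq_zero_of_isScalar (A : SingularMatrix F s) (hA : IsScalar A.1) :
    A.1 = 0 := by
  obtain ⟨u, hu⟩ := hA
  have hdet := A.2.2
  rw [hu, det_smul, det_one, mul_one, Fintype.card_fin] at hdet
  rw [hu, pow_eq_zero_iff two_ne_zero |>.1 hdet, zero_smul]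

theorem SingularMatrix.not_isScalar (hs : s ≠ 0) (A : SingularMatrix F s) : ¬ IsScalar A.1 := by
  intro hA
  refine hs ?_
  rw [← A.2.1, A.eq_zero_of_isScalar hA, trace_zero]

/-- The projection onto the kernel of a rank-one idempotent along its image. -/
def complement (E : SingularMatrix F (1 : F)) : SingularMatrix F (1 : F) :=
  ⟨1 - E.1, by rw [trace_sub, trace_one, E.2.1, Fintype.card_fin]; norm_num, by
    have h := det_smul_add_smul_one (-1) 1 E.1
    rw [E.2.1, E.2.2, neg_one_smul, one_smul, neg_add_eq_sub] at h
    rw [h]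
    norm_num⟩

theorem complement_ne (E : SingularMatrix F (1 : F)) : complement E ≠ E := by
  intro h
  have hE : 1 - E.1 = E.1 := congrArg Subtype.val h
  have hmul := E.mul_self
  nth_rewrite 1 [← hE] at hmul
  rw [sub_mul, one_mul, E.mul_self, one_smul, sub_self] at hmul
  exact E.not_isScalar one_ne_zero ⟨0, by rw [← hmul, zero_smul]⟩

end SingularMatrices

section SplitTorus

variable {F : Type*} [Field F]

/-- The matrices with eigenvalues `1` and `c` on the image and the kernel of `E`. -/
def splitHom (E : SingularMatrix F (1 : F)) : F →* Matrix (Fin 2) (Fin 2) F where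
  toFun c := (1 - c) • E.1 + c • 1
  map_one' := by simp
  map_mul' c d := by
    have hE := E.mul_self
    simp only [mul_add, add_mul, Matrix.smul_mul, Matrix.mul_smul, hE, mul_one, one_mul]
    module

/-- The one-parameter subgroup of `PGL(2, F)` attached to the decomposition of the plane into
the image and the kernel of `E`. -/
def splitTorus (E : SingularMatrix F (1 : F)) : Fˣ →* PGL(2, F) :=
  ProjGenLinGroup.mk.comp (Units.map (splitHom E))

theorem trace_splitHom (E : SingularMatrix F (1 : F)) (c : F) : (splitHom E c).trace = 1 + c := by
  refine (trace_smul_add_smul_one _ _ _).trans ?_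
  rw [E.2.1]
  ring

theorem det_splitHom (E : SingularMatrix F (1 : F)) (c : F) : (splitHom E c).det = c := by
  refine (det_smul_add_smul_one _ _ _).trans ?_
  rw [E.2.1, E.2.2]
  ring

theorem not_isScalar_splitHom (E : SingularMatrix F (1 : F)) {c : F} (hc : c ≠ 1) :
    ¬ IsScalar (splitHom E c) := fun ⟨_, hu⟩ =>
  E.not_isScalar one_ne_zero (isScalar_of_smul_add_smul_one_eq (sub_ne_zero.2 hc.symm) hu)

theorem splitTorus_injective (E : SingularMatrix F (1 : F)) :
    Function.Injective (splitTorus E) := by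
  rw [injective_iff_map_eq_one]
  intro c hc
  by_contra hc1
  exact not_isScalar_splitHom E (Units.val_eq_one.not.2 hc1) (mk_eq_one_iff_isScalar.1 hc)

theorem torus_splitTorus (E : SingularMatrix F (1 : F)) {c : Fˣ} (hc : c ≠ 1) :
    torus (splitTorus E c) = (splitTorus E).range := by
  ext x
  obtain ⟨k, rfl⟩ := ProjGenLinGroup.mk_surjective x
  refine (mk_mem_torus_mk (g := Units.map (splitHom E) c)).trans ⟨fun hk => ?_, ?_⟩
  · obtain ⟨a, b, hab⟩ := eq_smul_one_add_smul_of_commute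
      (not_isScalar_splitHom E (Units.val_eq_one.not.2 hc)) hk
    have hkE : k.1 = (b * (1 - c)) • E.1 + (a + b * c) • 1 := by
      rw [hab]
      change a • 1 + b • ((1 - c.1) • E.1 + c.1 • 1) = _
      module
    have hdet : (a + b) * (a + b * c) ≠ 0 := by
      have h := (GeneralLinearGroup.det k).ne_zero
      rw [GeneralLinearGroup.val_det_apply, hkE, det_smul_add_smul_one, E.2.1, E.2.2] at h
      convert h using 1
      ring
    obtain ⟨hab0, habc0⟩ := mul_ne_zero_iff.1 hdet
    refine ⟨Units.mk0 ((a + b * c) / (a + b)) (div_ne_zero habc0 hab0),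
      mk_eq_mk_iff_smul.2 ⟨a + b, ?_⟩⟩
    change _ = (a + b) • ((1 - (a + b * c) / (a + b)) • E.1 + ((a + b * c) / (a + b)) • 1)
    rw [hkE]
    match_scalars <;> field_simp
    ring
  · rintro ⟨d, hd⟩
    refine (commute_of_mk_eq_mk hd ?_).symm
    change splitHom E c * splitHom E d = splitHom E d * splitHom E c
    rw [← map_mul, mul_comm, map_mul]

theorem splitTorus_complement (E : SingularMatrix F (1 : F)) (c : Fˣ) :
    splitTorus (complement E) c⁻¹ = splitTorus E c := by
  refine mk_eq_mk_iff_smul.2 ⟨c, ?_⟩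
  change (1 - c.1) • E.1 + c.1 • 1 = c.1 • ((1 - (c⁻¹).1) • (1 - E.1) + (c⁻¹).1 • 1)
  rw [smul_add, smul_smul, smul_smul, mul_sub, Units.mul_inv]
  module

theorem eq_or_eq_complement_of_splitTorus_eq {E E' : SingularMatrix F (1 : F)} {c c' : Fˣ}
    (hc : c ≠ 1) (h : splitTorus E c = splitTorus E' c') :
    E' = E ∧ c' = c ∨ E' = complement E ∧ c' = c⁻¹ := by
  obtain ⟨u, hu⟩ := mk_eq_mk_iff_smul.1 h
  have htrace : 1 + c'.1 = u * (1 + c.1) := by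
    rw [← trace_splitHom E', ← trace_splitHom E, ← smul_eq_mul, ← trace_smul]
    exact congrArg trace hu
  have hdet : c'.1 = u ^ 2 * c.1 := by
    have h := congrArg det hu
    rw [det_smul, Fintype.card_fin] at h
    rw [← det_splitHom E' c', ← det_splitHom E c]
    exact h
  change (1 - c'.1) • E'.1 + c'.1 • 1 = u • ((1 - c.1) • E.1 + c.1 • 1) at hu
  have hu01 : (1 - u) * (1 - u * c.1) = 0 := by linear_combination htrace - hdet
  have hc1 (h : c' ≠ 1) : 1 - c'.1 ≠ 0 := sub_ne_zero.2 (Ne.symm (Units.val_eq_one.not.2 h))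
  rcases mul_eq_zero.1 hu01 with hu1 | huc
  · obtain rfl : u = 1 := (sub_eq_zero.1 hu1).symm
    have hcc : c' = c := Units.ext (by rw [hdet, one_pow, one_mul])
    subst hcc
    rw [one_smul, add_left_inj] at hu
    exact Or.inl ⟨Subtype.ext (smul_right_injective _ (hc1 hc) hu), rfl⟩
  · have huc1 : u * c.1 = 1 := (sub_eq_zero.1 huc).symm
    have hcc : c' = c⁻¹ := by
      refine eq_inv_of_mul_eq_one_left (Units.ext ?_)
      rw [Units.val_mul, hdet, Units.val_one]
      linear_combination (u * c.1 + 1) * huc1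
    refine Or.inr ⟨Subtype.ext (smul_right_injective _ (hc1 (hcc ▸ inv_ne_one.2 hc)) ?_), hcc⟩
    change (1 - c'.1) • E'.1 = (1 - c'.1) • (1 - E.1)
    rw [← add_left_inj (c'.1 • (1 : Matrix (Fin 2) (Fin 2) F)), hu]
    have huc' : c'.1 = u := by linear_combination hdet + u * huc1
    rw [huc', smul_add, smul_smul, smul_smul, mul_sub, huc1]
    module

end SplitTorus

section Unipotent

variable {F : Type*} [Field F]

/-- The unipotent matrix `1 + N` attached to a nilpotent matrix `N`. -/
def unipotent (N : SingularMatrix F (0 : F)) : GL (Fin 2) F where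
  val := 1 + N.1
  inv := 1 - N.1
  val_inv := by simp [add_mul, mul_sub, N.mul_self]
  inv_val := by simp [sub_mul, mul_add, N.mul_self]

theorem mk_unipotent_injective :
    Function.Injective fun N : SingularMatrix F (0 : F) => ProjGenLinGroup.mk (unipotent N) := by
  intro N N' h
  obtain ⟨u, hu⟩ := mk_eq_mk_iff_smul.1 h
  have htrace (M : SingularMatrix F (0 : F)) : (unipotent M).1.trace = 2 := by
    change (1 + M.1).trace = 2
    rw [trace_add, trace_one, M.2.1, Fintype.card_fin, add_zero, Nat.cast_ofNat]
  have hdet (M : SingularMatrix F (0 : F)) : (unipotent M).1.det = 1 := by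
    have h := det_smul_add_smul_one 1 1 M.1
    rw [M.2.1, M.2.2, one_smul, one_smul, add_comm M.1] at h
    exact h.trans (by ring)
  have hu1 : 2 = u * 2 := by
    rw [← htrace N, ← smul_eq_mul, ← trace_smul, ← hu, htrace N', htrace N]
  have hu2 : 1 = u ^ 2 := by
    have h := congrArg det hu
    rwa [det_smul, Fintype.card_fin, hdet, hdet, mul_one] at h
  obtain rfl : u = 1 := by
    rw [← sub_eq_zero, ← sq_eq_zero_iff]
    linear_combination hu1 - hu2
  exact Subtype.ext (add_left_cancel (hu.trans (one_smul F _))).symm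

theorem mk_unipotent_ne_one {N : SingularMatrix F (0 : F)} (hN : N.1 ≠ 0) :
    ProjGenLinGroup.mk (unipotent N) ≠ 1 := by
  rw [Ne, mk_eq_one_iff_isScalar]
  rintro ⟨u, hu⟩
  refine hN (N.eq_zero_of_isScalar
    (isScalar_of_smul_add_smul_one_eq one_ne_zero (y := 1) (z := u) ?_))
  rw [one_smul, one_smul, add_comm]
  exact hu

theorem orderOf_mk_unipotent (p : ℕ) [hp : Fact p.Prime] [CharP F p] {N : SingularMatrix F (0 : F)}
    (hN : N.1 ≠ 0) : orderOf (ProjGenLinGroup.mk (unipotent N)) = p := by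
  refine orderOf_eq_prime ?_ (mk_unipotent_ne_one hN)
  have hpow : (1 + N.1) ^ p = 1 := by
    obtain ⟨k, hk⟩ := Nat.exists_eq_add_of_le hp.out.two_le
    have hNp : N.1 ^ p = 0 := by rw [hk, pow_add, pow_two, N.mul_self, zero_smul, zero_mul]
    rw [add_pow_char_of_commute p (Commute.one_left N.1), one_pow, hNp, add_zero]
  rw [← map_pow, show unipotent N ^ p = 1 from Units.ext hpow, map_one]

end Unipotent

section NonsplitTorus

variable {F : Type*} [Field F]

/-- The algebra generated by a matrix `A`, as the image of the quadratic algebra defined by its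
characteristic polynomial. -/
def quadraticHom (A : Matrix (Fin 2) (Fin 2) F) :
    QuadraticAlgebra F (-A.det) A.trace →ₐ[F] Matrix (Fin 2) (Fin 2) F :=
  QuadraticAlgebra.lift ⟨A, mul_self_eq_smul_one_add_smul A⟩

theorem quadraticHom_apply (A : Matrix (Fin 2) (Fin 2) F)
    (z : QuadraticAlgebra F (-A.det) A.trace) : quadraticHom A z = z.re • 1 + z.im • A := by
  simp [quadraticHom, QuadraticAlgebra.lift]

/-- `A` has no eigenvalue in `F`; the equation is the hypothesis making
`QuadraticAlgebra F (-A.det) A.trace` a field. -/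
def HasNoEigenvalue (A : Matrix (Fin 2) (Fin 2) F) : Prop :=
  ∀ r : F, r ^ 2 ≠ -A.det + A.trace * r

theorem HasNoEigenvalue.not_isScalar {A : Matrix (Fin 2) (Fin 2) F} (hA : HasNoEigenvalue A) :
    ¬ IsScalar A := by
  rintro ⟨u, rfl⟩
  refine hA u ?_
  rw [det_smul, det_one, trace_smul, trace_one, Fintype.card_fin, smul_eq_mul]
  push_cast
  ring

/-- The units of the quadratic field generated by a matrix without eigenvalues, mapped to
`PGL(2, F)`. -/
def nonsplitHom (A : Matrix (Fin 2) (Fin 2) F) :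
    (QuadraticAlgebra F (-A.det) A.trace)ˣ →* PGL(2, F) :=
  ProjGenLinGroup.mk.comp (Units.map (quadraticHom A).toMonoidHom)

theorem range_nonsplitHom {g : GL (Fin 2) F} (hg : HasNoEigenvalue g.1) :
    (nonsplitHom g.1).range = torus (ProjGenLinGroup.mk g) := by
  have : Fact (∀ r : F, r ^ 2 ≠ -g.1.det + g.1.trace * r) := ⟨hg⟩
  ext x
  constructor
  · rintro ⟨z, rfl⟩
    refine mk_mem_torus_mk.2 ?_
    change Commute (quadraticHom g.1 z.1) g.1
    rw [quadraticHom_apply]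
    exact ((Commute.one_left g.1).smul_left _).add_left ((Commute.refl g.1).smul_left _)
  · intro hx
    obtain ⟨k, rfl⟩ := ProjGenLinGroup.mk_surjective x
    obtain ⟨a, b, hab⟩ := eq_smul_one_add_smul_of_commute hg.not_isScalar (mk_mem_torus_mk.1 hx)
    have hz : quadraticHom g.1 ⟨a, b⟩ = k.1 := by rw [quadraticHom_apply, hab]
    have hz0 : (⟨a, b⟩ : QuadraticAlgebra F (-g.1.det) g.1.trace) ≠ 0 := by
      intro h0
      exact k.ne_zero (by rw [← hz, h0, map_zero])
    exact ⟨Units.mk0 _ hz0, congrArg ProjGenLinGroup.mk (Units.ext hz)⟩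

theorem ker_nonsplitHom {A : Matrix (Fin 2) (Fin 2) F} (hA : ¬ IsScalar A) :
    (nonsplitHom A).ker = (Units.map (algebraMap F
      (QuadraticAlgebra F (-A.det) A.trace)).toMonoidHom).range := by
  ext z
  refine (mk_eq_one_iff_isScalar (g := Units.map (quadraticHom A).toMonoidHom z)).trans ?_
  change IsScalar (quadraticHom A z.1) ↔ _
  constructor
  · intro hz
    have him : z.1.im = 0 := by
      by_contra him
      obtain ⟨u, hu⟩ := hz
      rw [quadraticHom_apply, add_comm] at hu
      exact hA (isScalar_of_smul_add_smul_one_eq him hu)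
    have hz' : algebraMap F _ z.1.re = z.1 := QuadraticAlgebra.ext rfl him.symm
    have hre : z.1.re ≠ 0 := by
      intro hre
      exact z.ne_zero (by rw [← hz', hre, map_zero])
    exact ⟨Units.mk0 _ hre, Units.ext hz'⟩
  · rintro ⟨u, rfl⟩
    exact ⟨u.1, (quadraticHom A).commutes u.1 |>.trans (Algebra.algebraMap_eq_smul_one _)⟩

theorem isCyclic_torus_of_hasNoEigenvalue [Finite F] {g : GL (Fin 2) F}
    (hg : HasNoEigenvalue g.1) : IsCyclic (torus (ProjGenLinGroup.mk g)) := by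
  have : Fact (∀ r : F, r ^ 2 ≠ -g.1.det + g.1.trace * r) := ⟨hg⟩
  have : Finite (QuadraticAlgebra F (-g.1.det) g.1.trace) :=
    Finite.of_equiv _ (QuadraticAlgebra.equivProd _ _).symm
  rw [← range_nonsplitHom hg]
  exact isCyclic_of_surjective _ (nonsplitHom g.1).rangeRestrict_surjective

theorem natCard_torus_of_hasNoEigenvalue [Finite F] {g : GL (Fin 2) F}
    (hg : HasNoEigenvalue g.1) : Nat.card (torus (ProjGenLinGroup.mk g)) = Nat.card F + 1 := by
  have : Fact (∀ r : F, r ^ 2 ≠ -g.1.det + g.1.trace * r) := ⟨hg⟩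
  set K := QuadraticAlgebra F (-g.1.det) g.1.trace
  have hK : Nat.card Kˣ = (Nat.card F - 1) * (Nat.card F + 1) := by
    have : Finite K := Finite.of_equiv _ (QuadraticAlgebra.equivProd _ _).symm
    rw [Nat.card_units, Nat.card_congr (QuadraticAlgebra.equivProd _ _), Nat.card_prod,
      mul_comm (_ - 1), ← Nat.sq_sub_sq, one_pow, pow_two]
  have hker : Nat.card (nonsplitHom g.1).ker = Nat.card F - 1 := by
    rw [ker_nonsplitHom hg.not_isScalar, ← Nat.card_units]
    exact Nat.card_congr (MonoidHom.ofInjective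
      (Units.map_injective (algebraMap F K).injective)).symm.toEquiv
  have hindex := Subgroup.card_mul_index (nonsplitHom g.1).ker
  rw [Subgroup.index_ker, range_nonsplitHom hg, hker, hK] at hindex
  exact Nat.eq_of_mul_eq_mul_left (Nat.sub_pos_of_lt Finite.one_lt_card) hindex

end NonsplitTorus

section Classification

variable {F : Type*} [Field F]

/-- `x` is the class of a matrix with two distinct eigenvalues in `F`. -/
def IsSplit (x : PGL(2, F)) : Prop :=
  ∃ (E : SingularMatrix F (1 : F)) (c : Fˣ), c ≠ 1 ∧ splitTorus E c = x

/-- `x` is the class of a matrix without eigenvalues in `F`. -/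
def IsNonsplit (x : PGL(2, F)) : Prop :=
  ∃ g : GL (Fin 2) F, HasNoEigenvalue g.1 ∧ ProjGenLinGroup.mk g = x

/-- `x` is the class of a nontrivial unipotent matrix, that is, of a nonscalar matrix with a double
eigenvalue in `F`. -/
def IsUnipotent (x : PGL(2, F)) : Prop :=
  ∃ N : SingularMatrix F (0 : F), N.1 ≠ 0 ∧ ProjGenLinGroup.mk (unipotent N) = x

theorem isSplit_mk {g : GL (Fin 2) F} {a b : F} (hab : a ≠ b) (htrace : g.1.trace = a + b)
    (hdet : g.1.det = a * b) : IsSplit (ProjGenLinGroup.mk g) := by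
  have hsub : a - b ≠ 0 := sub_ne_zero.2 hab
  obtain ⟨ha, hb⟩ : a ≠ 0 ∧ b ≠ 0 := by
    rw [← mul_ne_zero_iff, ← hdet]
    exact (GeneralLinearGroup.det g).ne_zero
  let E : SingularMatrix F (1 : F) := ⟨(a - b)⁻¹ • g.1 + (-(a - b)⁻¹ * b) • 1, by
    rw [trace_smul_add_smul_one, htrace]
    field_simp
    ring, by
    rw [det_smul_add_smul_one, htrace, hdet]
    ring⟩
  refine ⟨E, Units.mk0 (b / a) (div_ne_zero hb ha), ?_, (mk_eq_mk_iff_smul.2 ⟨a⁻¹, ?_⟩).symm⟩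
  · exact fun h => hab ((div_eq_one_iff_eq ha).1 (congrArg Units.val h)).symm
  · change (1 - b / a) • ((a - b)⁻¹ • g.1 + (-(a - b)⁻¹ * b) • 1) + (b / a) • 1 = a⁻¹ • g.1
    match_scalars <;> field_simp
    ring

theorem isUnipotent_mk {g : GL (Fin 2) F} {a : F} (hg : ¬ IsScalar g.1)
    (htrace : g.1.trace = 2 * a) (hdet : g.1.det = a ^ 2) :
    IsUnipotent (ProjGenLinGroup.mk g) := by
  have ha : a ≠ 0 := by
    rintro rfl
    exact (GeneralLinearGroup.det g).ne_zero (hdet.trans (zero_pow two_ne_zero))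
  let N : SingularMatrix F (0 : F) := ⟨a⁻¹ • g.1 + (-1 : F) • 1, by
    rw [trace_smul_add_smul_one, htrace]
    field_simp
    ring, by
    rw [det_smul_add_smul_one, htrace, hdet]
    field_simp
    ring⟩
  refine ⟨N, fun hN => hg ?_, (mk_eq_mk_iff_smul.2 ⟨a⁻¹, ?_⟩).symm⟩
  · exact isScalar_of_smul_add_smul_one_eq (inv_ne_zero ha) (hN.trans (zero_smul F _).symm)
  · change 1 + (a⁻¹ • g.1 + (-1 : F) • 1) = a⁻¹ • g.1
    module

theorem isSplit_or_isNonsplit_or_isUnipotent {x : PGL(2, F)} (hx : x ≠ 1) :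
    IsSplit x ∨ IsNonsplit x ∨ IsUnipotent x := by
  obtain ⟨g, rfl⟩ := ProjGenLinGroup.mk_surjective x
  by_cases hg : HasNoEigenvalue g.1
  · exact Or.inr (Or.inl ⟨g, hg, rfl⟩)
  obtain ⟨a, ha⟩ : ∃ a, a ^ 2 = -g.1.det + g.1.trace * a := by
    simpa only [HasNoEigenvalue, not_forall, not_not] using hg
  by_cases hab : a = g.1.trace - a
  · exact Or.inr (Or.inr (isUnipotent_mk (a := a) (mk_eq_one_iff_isScalar.not.1 hx)
      (by linear_combination -hab) (by linear_combination ha - a * hab)))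
  · exact Or.inl (isSplit_mk hab (by ring) (by linear_combination ha))

theorem IsSplit.ne_one {x : PGL(2, F)} (hx : IsSplit x) : x ≠ 1 := by
  obtain ⟨E, c, hc, rfl⟩ := hx
  exact (map_ne_one_iff _ (splitTorus_injective E)).2 hc

theorem IsNonsplit.ne_one {x : PGL(2, F)} (hx : IsNonsplit x) : x ≠ 1 := by
  obtain ⟨g, hg, rfl⟩ := hx
  exact mk_eq_one_iff_isScalar.not.2 hg.not_isScalar

theorem IsUnipotent.ne_one {x : PGL(2, F)} (hx : IsUnipotent x) : x ≠ 1 := by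
  obtain ⟨N, hN, rfl⟩ := hx
  exact mk_unipotent_ne_one hN

theorem IsUnipotent.orderOf_eq (p : ℕ) [Fact p.Prime] [CharP F p] {x : PGL(2, F)}
    (hx : IsUnipotent x) : orderOf x = p := by
  obtain ⟨N, hN, rfl⟩ := hx
  exact orderOf_mk_unipotent p hN

theorem IsSplit.isCyclic_torus [Finite F] {x : PGL(2, F)} (hx : IsSplit x) :
    IsCyclic (torus x) := by
  obtain ⟨E, c, hc, rfl⟩ := hx
  rw [torus_splitTorus E hc]
  exact isCyclic_of_surjective _ (splitTorus E).rangeRestrict_surjective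

theorem IsSplit.natCard_torus {x : PGL(2, F)} (hx : IsSplit x) :
    Nat.card (torus x) = Nat.card F - 1 := by
  obtain ⟨E, c, hc, rfl⟩ := hx
  rw [torus_splitTorus E hc, ← Nat.card_units]
  exact (Nat.card_congr (MonoidHom.ofInjective (splitTorus_injective E)).toEquiv).symm

theorem IsNonsplit.isCyclic_torus [Finite F] {x : PGL(2, F)} (hx : IsNonsplit x) :
    IsCyclic (torus x) := by
  obtain ⟨g, hg, rfl⟩ := hx
  exact isCyclic_torus_of_hasNoEigenvalue hg

theorem IsNonsplit.natCard_torus [Finite F] {x : PGL(2, F)} (hx : IsNonsplit x) :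
    Nat.card (torus x) = Nat.card F + 1 := by
  obtain ⟨g, hg, rfl⟩ := hx
  exact natCard_torus_of_hasNoEigenvalue hg

end Classification

section CyclicPart

instance finite_projGenLinGroup {n R : Type*} [Fintype n] [DecidableEq n] [CommRing R] [Finite R] :
    Finite (ProjGenLinGroup n R) :=
  Finite.of_surjective _ ProjGenLinGroup.mk_surjective

variable {F : Type*} [Field F]

theorem not_isUnipotent_of_mem_torus [Finite F] {x y : PGL(2, F)}
    (hx : IsSplit x ∨ IsNonsplit x) (hy : y ∈ torus x) : ¬ IsUnipotent y := by
  intro hunipotent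
  obtain ⟨p, hchar⟩ := CharP.exists F
  have hp : Fact p.Prime := ⟨CharP.char_is_prime F p⟩
  have hpF : p ∣ Nat.card F := by
    rw [← CharP.cast_eq_zero_iff F p, ← nsmul_one, card_nsmul_eq_zero']
  have hdvd : p ∣ Nat.card (torus x) := by
    rw [← hunipotent.orderOf_eq p]
    exact Subgroup.orderOf_dvd_natCard _ hy
  refine hp.out.ne_one (Nat.dvd_one.1 ?_)
  rcases hx with hx | hx
  · rw [hx.natCard_torus] at hdvd
    exact (Nat.dvd_sub_iff_right Nat.card_pos hpF).1 hdvd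
  · rw [hx.natCard_torus] at hdvd
    exact (Nat.dvd_add_right hpF).1 hdvd

open Classical in
/-- The part containing `x` of the partition of `PGL(2, F)` by cyclic subgroups. A unipotent element
only spans a subgroup of prime order, its torus being noncyclic in general. -/
noncomputable def cyclicPart (x : PGL(2, F)) : Subgroup PGL(2, F) :=
  if IsUnipotent x then Subgroup.zpowers x else torus x

theorem IsUnipotent.cyclicPart_eq {x : PGL(2, F)} (hx : IsUnipotent x) :
    cyclicPart x = Subgroup.zpowers x :=
  if_pos hx

theorem cyclicPart_eq_torus {x : PGL(2, F)} (hx : ¬ IsUnipotent x) : cyclicPart x = torus x :=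
  if_neg hx

theorem mem_cyclicPart (x : PGL(2, F)) : x ∈ cyclicPart x := by
  rw [cyclicPart]
  split_ifs
  exacts [Subgroup.mem_zpowers x, mem_torus_self x]

theorem IsSplit.cyclicPart_eq [Finite F] {x : PGL(2, F)} (hx : IsSplit x) :
    cyclicPart x = torus x :=
  cyclicPart_eq_torus (not_isUnipotent_of_mem_torus (Or.inl hx) (mem_torus_self x))

theorem IsNonsplit.cyclicPart_eq [Finite F] {x : PGL(2, F)} (hx : IsNonsplit x) :
    cyclicPart x = torus x :=
  cyclicPart_eq_torus (not_isUnipotent_of_mem_torus (Or.inr hx) (mem_torus_self x))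

theorem isCyclic_cyclicPart [Finite F] {x : PGL(2, F)} (hx : x ≠ 1) : IsCyclic (cyclicPart x) := by
  rcases isSplit_or_isNonsplit_or_isUnipotent hx with h | h | h
  · exact h.cyclicPart_eq ▸ h.isCyclic_torus
  · exact h.cyclicPart_eq ▸ h.isCyclic_torus
  · rw [h.cyclicPart_eq]
    infer_instance

theorem IsSplit.natCard_cyclicPart [Finite F] {x : PGL(2, F)} (hx : IsSplit x) :
    Nat.card (cyclicPart x) = Nat.card F - 1 := by
  rw [hx.cyclicPart_eq, hx.natCard_torus]

theorem IsNonsplit.natCard_cyclicPart [Finite F] {x : PGL(2, F)} (hx : IsNonsplit x) :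
    Nat.card (cyclicPart x) = Nat.card F + 1 := by
  rw [hx.cyclicPart_eq, hx.natCard_torus]

theorem IsUnipotent.natCard_cyclicPart (p : ℕ) [Fact p.Prime] [CharP F p] {x : PGL(2, F)}
    (hx : IsUnipotent x) : Nat.card (cyclicPart x) = p := by
  rw [hx.cyclicPart_eq, Nat.card_zpowers, hx.orderOf_eq p]

theorem cyclicPart_eq_of_mem [Finite F] {x y : PGL(2, F)} (hx : x ≠ 1) (hy : y ≠ 1)
    (hyx : y ∈ cyclicPart x) : cyclicPart y = cyclicPart x := by
  obtain ⟨p, hchar⟩ := CharP.exists F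
  have hp : Fact p.Prime := ⟨CharP.char_is_prime F p⟩
  by_cases hux : IsUnipotent x
  · have hzpowers : Subgroup.zpowers y = Subgroup.zpowers x := by
      rw [hux.cyclicPart_eq] at hyx
      refine Subgroup.eq_of_le_of_card_ge (Subgroup.zpowers_le.2 hyx) ?_
      have hdvd := Subgroup.orderOf_dvd_natCard _ hyx
      rw [Nat.card_zpowers, hux.orderOf_eq p, Nat.dvd_prime hp.out] at hdvd
      rw [Nat.card_zpowers, Nat.card_zpowers, hux.orderOf_eq p,
        hdvd.resolve_left (orderOf_eq_one_iff.not.2 hy)]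
    have huy : IsUnipotent y := by
      have hxy : x ∈ torus y := (Subgroup.zpowers_le.2 (mem_torus_self y)) <|
        hzpowers ▸ Subgroup.mem_zpowers x
      rcases isSplit_or_isNonsplit_or_isUnipotent hy with h | h | h
      · exact absurd hux (not_isUnipotent_of_mem_torus (Or.inl h) hxy)
      · exact absurd hux (not_isUnipotent_of_mem_torus (Or.inr h) hxy)
      · exact h
    rw [huy.cyclicPart_eq, hux.cyclicPart_eq, hzpowers]
  · rw [cyclicPart_eq_torus hux] at hyx ⊢
    have hx' : IsSplit x ∨ IsNonsplit x := by
      simpa only [hux, or_false] using isSplit_or_isNonsplit_or_isUnipotent hx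
    rw [cyclicPart_eq_torus (not_isUnipotent_of_mem_torus hx' hyx), torus_eq_of_mem hx hy hyx]

end CyclicPart

/-! ### Counting in `PGL(2, F)` -/

section Counting

variable {F : Type*} [Field F]

theorem card_mul_eq [Fintype F] [DecidableEq F] (d : F) :
    Fintype.card {x : F × F // x.1 * x.2 = d} =
      Fintype.card F - 1 + if d = 0 then Fintype.card F else 0 := by
  have card_fiber (b : F) (hb : b ≠ 0) : Fintype.card {c : F // b * c = d} = 1 := by
    simp only [mul_comm b, ← eq_div_iff hb]
    exact Fintype.card_subtype_eq _
  have card_zero_fiber :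
      Fintype.card {c : F // (0 : F) * c = d} = if d = 0 then Fintype.card F else 0 := by
    simp only [zero_mul, eq_comm (a := (0 : F)), Fintype.card_subtype, Finset.filter_const]
    split_ifs <;> rfl
  rw [← Fintype.card_congr (Equiv.subtypeProdEquivSigmaSubtype fun b c : F => b * c = d).symm,
    Fintype.card_sigma, ← Finset.sum_erase_add _ _ (Finset.mem_univ (0 : F)), card_zero_fiber,
    Finset.sum_congr rfl fun b hb => card_fiber b (Finset.ne_of_mem_erase hb), Finset.sum_const,
    Finset.card_erase_of_mem (Finset.mem_univ _), Finset.card_univ, smul_eq_mul, mul_one]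

/-- A singular matrix of trace `s` is determined by its upper left entry `a`, and by its
off-diagonal entries, whose product is `a * (s - a)`. -/
def singularMatrixEquiv (s : F) :
    SingularMatrix F s ≃ Σ a : F, {x : F × F // x.1 * x.2 = a * (s - a)} where
  toFun A := ⟨A.1 0 0, (A.1 0 1, A.1 1 0), by
    have htrace := A.2.1
    have hdet := A.2.2
    rw [trace_fin_two] at htrace
    rw [det_fin_two] at hdet
    linear_combination A.1 0 0 * htrace - hdet⟩
  invFun y := ⟨!![y.1, y.2.1.1; y.2.1.2, s - y.1], by rw [trace_fin_two_of, add_sub_cancel], by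
    rw [det_fin_two_of, y.2.2, sub_self]⟩
  left_inv A := by
    have htrace : s - A.1 0 0 = A.1 1 1 :=
      sub_eq_iff_eq_add'.2 (A.2.1.symm.trans (trace_fin_two A.1))
    refine Subtype.ext (Eq.trans ?_ (eta_fin_two A.1).symm)
    exact congrArg (fun d => !![A.1 0 0, A.1 0 1; A.1 1 0, d]) htrace
  right_inv _ := rfl

theorem natCard_singularMatrix [Finite F] [DecidableEq F] (s : F) :
    Nat.card (SingularMatrix F s) =
      Nat.card F * (Nat.card F - 1) + ({0, s} : Finset F).card * Nat.card F := by
  have := Fintype.ofFinite F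
  have hroots (a : F) : a * (s - a) = 0 ↔ a ∈ ({0, s} : Finset F) := by
    rw [mul_eq_zero, sub_eq_zero, Finset.mem_insert, Finset.mem_singleton, eq_comm (a := s)]
  rw [Nat.card_congr (singularMatrixEquiv s), Nat.card_eq_fintype_card, Fintype.card_sigma,
    Finset.sum_congr rfl fun a _ => card_mul_eq (a * (s - a)), Finset.sum_add_distrib]
  simp only [hroots, Finset.sum_ite_mem, Finset.univ_inter, Finset.sum_const, Finset.card_univ,
    smul_eq_mul, Nat.card_eq_fintype_card]

theorem natCard_projGenLinGroup [Finite F] :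
    Nat.card PGL(2, F) = Nat.card F ^ 3 - Nat.card F := by
  have := Fintype.ofFinite F
  have hker : Nat.card (ProjGenLinGroup.mk (n := Fin 2) (R := F)).ker = Nat.card F - 1 := by
    rw [ProjGenLinGroup.ker_mk, GeneralLinearGroup.center_eq_range_scalar, ← Nat.card_units F]
    have hscalar : Function.Injective (GeneralLinearGroup.scalar (R := F) (Fin 2)) := by
      intro u w huw
      have h00 := congrArg (fun g : GL (Fin 2) F => g.1 0 0) huw
      exact Units.ext h00
    exact (Nat.card_congr (MonoidHom.ofInjective hscalar).toEquiv).symm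
  have hcard := Subgroup.card_mul_index (ProjGenLinGroup.mk (n := Fin 2) (R := F)).ker
  rw [Subgroup.index_ker, MonoidHom.range_eq_top.2 ProjGenLinGroup.mk_surjective,
    Subgroup.card_top, hker, card_GL_field, Fin.prod_univ_two, ← Nat.card_eq_fintype_card,
    Fin.val_zero, Fin.val_one, pow_zero, pow_one] at hcard
  have hq : 1 < Nat.card F := Finite.one_lt_card
  refine Nat.eq_of_mul_eq_mul_left (Nat.sub_pos_of_lt hq) (hcard.trans ?_)
  generalize Nat.card F = q at hq
  zify [hq.le, Nat.one_le_pow 2 q (by lia), Nat.le_self_pow two_ne_zero q,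
    Nat.le_self_pow three_ne_zero q]
  ring

theorem two_mul_natCard_isSplit [Finite F] :
    2 * Nat.card {x : PGL(2, F) // IsSplit x} =
      (Nat.card F ^ 2 + Nat.card F) * (Nat.card F - 2) := by
  classical
  have := Fintype.ofFinite F
  let S := SingularMatrix F (1 : F) × {c : Fˣ // c ≠ 1}
  have := Fintype.ofFinite S
  have := Fintype.ofFinite PGL(2, F)
  let f : S → PGL(2, F) := fun a => splitTorus a.1 a.2
  have card_fiber (x : PGL(2, F)) (hx : x ∈ Finset.univ.filter IsSplit) :
      (Finset.univ.filter fun a => f a = x).card = 2 := by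
    obtain ⟨E, c, hc, rfl⟩ := (Finset.mem_filter.1 hx).2
    rw [Finset.card_eq_two]
    refine ⟨(E, ⟨c, hc⟩), (complement E, ⟨c⁻¹, inv_ne_one.2 hc⟩),
      fun h => complement_ne E (congrArg Prod.fst h).symm, ?_⟩
    ext ⟨E', c', hc'⟩
    rw [Finset.mem_filter_univ, Finset.mem_insert, Finset.mem_singleton]
    constructor
    · intro h
      obtain ⟨rfl, rfl⟩ | ⟨rfl, rfl⟩ := eq_or_eq_complement_of_splitTorus_eq hc h.symm
      exacts [Or.inl rfl, Or.inr rfl]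
    · rintro (h | h) <;> cases h
      exacts [rfl, splitTorus_complement E c]
  have hS : Nat.card S = (Nat.card F ^ 2 + Nat.card F) * (Nat.card F - 2) := by
    rw [Nat.card_prod, natCard_singularMatrix, Finset.card_pair zero_ne_one,
      Nat.card_eq_fintype_card (α := {c : Fˣ // c ≠ 1}), Fintype.card_subtype_compl,
      Fintype.card_subtype_eq, ← Nat.card_eq_fintype_card, Nat.card_units, Nat.sub_sub]
    congr 1
    zify [(Finite.one_lt_card (α := F)).le]
    ring
  rw [← hS, Nat.card_eq_fintype_card, Nat.card_eq_fintype_card, Fintype.card_subtype,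
    ← Finset.card_univ, Finset.card_eq_sum_card_fiberwise (f := f) (t := Finset.univ.filter IsSplit)
      fun a _ => Finset.mem_filter.2 ⟨Finset.mem_univ _, a.1, a.2, a.2.2, rfl⟩,
    Finset.sum_congr rfl card_fiber, Finset.sum_const, smul_eq_mul, mul_comm]

theorem natCard_isUnipotent [Finite F] :
    Nat.card {x : PGL(2, F) // IsUnipotent x} = Nat.card F ^ 2 - 1 := by
  classical
  have := Fintype.ofFinite (SingularMatrix F (0 : F))
  let zero : SingularMatrix F (0 : F) := ⟨0, trace_zero _ _, det_zero⟩
  let f : {N : SingularMatrix F (0 : F) // N ≠ zero} → {x : PGL(2, F) // IsUnipotent x} :=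
    fun N => ⟨ProjGenLinGroup.mk (unipotent N.1), N.1, Subtype.coe_ne_coe.2 N.2, rfl⟩
  have hf : Function.Bijective f := by
    constructor
    · exact fun N N' h => Subtype.ext (mk_unipotent_injective (congrArg Subtype.val h))
    · rintro ⟨_, N, hN, rfl⟩
      exact ⟨⟨N, Subtype.coe_ne_coe.1 hN⟩, rfl⟩
  have hcard := natCard_singularMatrix (0 : F)
  rw [Finset.pair_eq_singleton, Finset.card_singleton, one_mul, ← Nat.mul_succ, Nat.succ_eq_add_one,
    Nat.sub_add_cancel Nat.card_pos, ← pow_two] at hcard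
  rw [← Nat.card_congr (Equiv.ofBijective f hf), Nat.card_eq_fintype_card,
    Fintype.card_subtype_compl, Fintype.card_subtype_eq, ← Nat.card_eq_fintype_card, hcard]

end Counting

/-! ### The partition of `PGL(2, F)` -/

section Partition

variable {G κ : Type*} [Group G] [Finite G]

theorem exists_isCyclicPartition {M : G → Subgroup G} {n : κ → ℕ} {P : κ → G → Prop}
    (hn : Function.Injective n) (hP : ∀ g, g ≠ 1 ↔ ∃ k, P k g)
    (hmem : ∀ g, g ∈ M g) (hcyclic : ∀ g, g ≠ 1 → IsCyclic (M g))
    (hcard : ∀ k g, P k g → Nat.card (M g) = n k)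
    (heq : ∀ g h, g ≠ 1 → h ≠ 1 → h ∈ M g → M h = M g) :
    ∃ τ : M '' {1}ᶜ → κ, IsCyclicPartition (fun Z : M '' {1}ᶜ => Z.1) τ n ∧
      ∀ k, Nat.card {Z // τ Z = k} * (n k - 1) = Nat.card {g // P k g} := by
  have hkind (Z : M '' {1}ᶜ) : ∃ k, Nat.card Z.1 = n k := by
    obtain ⟨_, g, hg, rfl⟩ := Z
    obtain ⟨k, hk⟩ := (hP g).1 hg
    exact ⟨k, hcard k g hk⟩
  choose τ hτ using hkind
  have heqZ (Z : M '' {1}ᶜ) (g : G) (hg : g ≠ 1) (hgZ : g ∈ Z.1) : M g = Z.1 := by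
    obtain ⟨_, x, hx, rfl⟩ := Z
    exact heq x g hx hg hgZ
  have hpartition : IsCyclicPartition (fun Z : M '' {1}ᶜ => Z.1) τ n :=
    { isCyclic := by
        rintro ⟨_, g, hg, rfl⟩
        exact hcyclic g hg
      natCard_eq := hτ
      exists_mem := fun g hg => ⟨⟨M g, g, hg, rfl⟩, hmem g⟩
      eq_of_mem := fun g hg Y Z hY hZ =>
        Subtype.ext ((heqZ Y g hg hY).symm.trans (heqZ Z g hg hZ)) }
  refine ⟨τ, hpartition, fun k => ?_⟩
  rw [← hpartition.natCard_ne_one]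
  refine Nat.card_congr (Equiv.subtypeEquivRight fun g => ⟨?_, fun hk => ?_⟩)
  · rintro ⟨Z, rfl, hgZ, hg⟩
    obtain ⟨k, hk⟩ := (hP g).1 hg
    rwa [hn ((hτ Z).symm.trans (heqZ Z g hg hgZ ▸ hcard k g hk))]
  · have hg : g ≠ 1 := (hP g).2 ⟨k, hk⟩
    exact ⟨⟨M g, g, hg, rfl⟩, hn ((hτ _).symm.trans (hcard k g hk)), hmem g, hg⟩

end Partition

theorem eq_div_two_of_mul_sub_two {q a : ℕ} (hq : 2 < q)
    (ha : 2 * (a * (q - 1 - 1)) = (q ^ 2 + q) * (q - 2)) : a = q * (q + 1) / 2 := by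
  symm
  refine Nat.div_eq_of_eq_mul_right two_pos (Nat.eq_of_mul_eq_mul_right (Nat.sub_pos_of_lt hq) ?_)
  rw [Nat.sub_sub] at ha
  linear_combination -ha

theorem eq_div_two_of_add_eq {q a b : ℕ} (hq : 1 < q)
    (ha : 2 * (a * (q - 1 - 1)) = (q ^ 2 + q) * (q - 2))
    (htotal : q ^ 3 - q = a * (q - 1 - 1) + b * (q + 1 - 1) + (q ^ 2 - 1) + 1) :
    b = q * (q - 1) / 2 := by
  have hq0 : 0 < q := by lia
  refine (Nat.div_eq_of_eq_mul_right two_pos (Nat.eq_of_mul_eq_mul_right hq0 ?_)).symm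
  rw [Nat.sub_sub, Nat.add_sub_cancel] at *
  zify [hq.le, show 1 + 1 ≤ q from hq, show 2 ≤ q from hq, Nat.one_le_pow 2 q hq0,
    Nat.le_self_pow three_ne_zero q] at ha htotal ⊢
  linear_combination ha + 2 * htotal

section ProjGenLinGroup

variable {F : Type*} [Field F] [Finite F] (p : ℕ) [Fact p.Prime] [CharP F p]

theorem injective_natCard_cyclicPart :
    Function.Injective ![Nat.card F - 1, Nat.card F + 1, p] := by
  have hp : ¬ p ∣ 1 := (Fact.out : p.Prime).not_dvd_one
  have hpF : p ∣ Nat.card F := by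
    rw [← CharP.cast_eq_zero_iff F p, ← nsmul_one, card_nsmul_eq_zero']
  have hsub : Nat.card F - 1 ≠ p := fun h =>
    hp ((Nat.dvd_sub_iff_right Nat.card_pos hpF).1 h.symm.dvd)
  have hadd : Nat.card F + 1 ≠ p := fun h => hp ((Nat.dvd_add_right hpF).1 h.symm.dvd)
  intro k l h
  fin_cases k <;> fin_cases l <;>
    simp only [Fin.zero_eta, Fin.mk_one, Fin.reduceFinMk, Matrix.cons_val] at h ⊢ <;> lia

theorem exists_isCyclicPartition_projGenLinGroup :
    ∃ τ : cyclicPart '' ({1}ᶜ : Set PGL(2, F)) → Fin 3,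
      IsCyclicPartition (fun Z : cyclicPart '' ({1}ᶜ : Set PGL(2, F)) => Z.1) τ
        ![Nat.card F - 1, Nat.card F + 1, p] ∧
      2 * (Nat.card {Z // τ Z = 0} * (Nat.card F - 1 - 1)) =
        (Nat.card F ^ 2 + Nat.card F) * (Nat.card F - 2) ∧
      Nat.card {Z // τ Z = 2} * (p - 1) = Nat.card F ^ 2 - 1 := by
  let P : Fin 3 → PGL(2, F) → Prop := ![IsSplit, IsNonsplit, IsUnipotent]
  have hP (x : PGL(2, F)) : x ≠ 1 ↔ ∃ k, P k x := by
    simp only [Fin.exists_fin_succ, Fin.exists_fin_zero, or_false]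
    exact ⟨isSplit_or_isNonsplit_or_isUnipotent,
      fun h => h.elim IsSplit.ne_one (Or.rec IsNonsplit.ne_one IsUnipotent.ne_one)⟩
  have hcard (k : Fin 3) (x : PGL(2, F)) (hx : P k x) :
      Nat.card (cyclicPart x) = ![Nat.card F - 1, Nat.card F + 1, p] k := by
    fin_cases k
    exacts [IsSplit.natCard_cyclicPart hx, IsNonsplit.natCard_cyclicPart hx,
      IsUnipotent.natCard_cyclicPart p hx]
  obtain ⟨τ, hτ, hcount⟩ := exists_isCyclicPartition (injective_natCard_cyclicPart (F := F) p)
    hP mem_cyclicPart (fun _ => isCyclic_cyclicPart) hcard fun _ _ => cyclicPart_eq_of_mem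
  exact ⟨τ, hτ, (congrArg (2 * ·) (hcount 0)).trans two_mul_natCard_isSplit,
    (hcount 2).trans natCard_isUnipotent⟩

theorem exists_isCyclicPartition_natCard_eq :
    ∃ τ : cyclicPart '' ({1}ᶜ : Set PGL(2, F)) → Fin 3,
      IsCyclicPartition (fun Z : cyclicPart '' ({1}ᶜ : Set PGL(2, F)) => Z.1) τ
        ![Nat.card F - 1, Nat.card F + 1, p] ∧
      ∀ k, ![Nat.card F - 1, Nat.card F + 1, p] k ≠ 1 → Nat.card {Z // τ Z = k} =
        ![Nat.card F * (Nat.card F + 1) / 2, Nat.card F * (Nat.card F - 1) / 2,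
          (Nat.card F ^ 2 - 1) / (p - 1)] k := by
  obtain ⟨τ, hτ, hsplit, hunipotent⟩ := exists_isCyclicPartition_projGenLinGroup (F := F) p
  have htotal := hτ.natCard_eq_sum_add_one
  rw [natCard_projGenLinGroup, Fin.sum_univ_three] at htotal
  simp only [Matrix.cons_val] at htotal
  rw [hunipotent] at htotal
  have hq : 1 < Nat.card F := Finite.one_lt_card
  have hp : 0 < p - 1 := Nat.sub_pos_of_lt (Fact.out : p.Prime).one_lt
  refine ⟨τ, hτ, fun k hk => ?_⟩
  fin_cases k
  · have hk2 : Nat.card F - 1 ≠ 1 := hk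
    exact eq_div_two_of_mul_sub_two (by lia) hsplit
  · exact eq_div_two_of_add_eq hq hsplit htotal
  · exact (Nat.div_eq_of_eq_mul_left hp hunipotent.symm).symm

end ProjGenLinGroup

/-! ### Isomorphisms of disjoint unions -/

section Isomorphic

theorem Isomorphic.refl {V : Type*} (G : Digraph V) : Isomorphic G G := ⟨RelIso.refl _⟩

theorem Isomorphic.trans {U V W : Type*} {G : Digraph U} {H : Digraph V} {K : Digraph W}
    (h : Isomorphic G H) (h' : Isomorphic H K) : Isomorphic G K :=
  ⟨h.some.trans h'.some⟩

theorem Isomorphic.disjSum {U V U' V' : Type*} {G : Digraph U} {H : Digraph V} {G' : Digraph U'}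
    {H' : Digraph V'} (h : Isomorphic G G') (h' : Isomorphic H H') :
    Isomorphic (disjSum G H) (disjSum G' H') := by
  obtain ⟨e⟩ := h
  obtain ⟨e'⟩ := h'
  refine ⟨⟨Equiv.sumCongr e.toEquiv e'.toEquiv, ?_⟩⟩
  rintro (x | x) (y | y) <;> simp [PowerMapGraph.disjSum, e.map_rel_iff, e'.map_rel_iff]

theorem unionAdj_mk_iff {ι : Type*} {V : ι → Type*} {G : (i : ι) → Digraph (V i)} {i : ι}
    {x y : V i} : UnionAdj G ⟨i, x⟩ ⟨i, y⟩ ↔ (G i).Adj x y :=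
  ⟨fun | .mk _ _ _ h => h, .mk i x y⟩

theorem UnionAdj.fst_eq {ι : Type*} {V : ι → Type*} {G : (i : ι) → Digraph (V i)}
    {x y : Σ i, V i} : UnionAdj G x y → x.1 = y.1
  | .mk _ _ _ _ => rfl

theorem isomorphic_disjUnion_of_unique {ι : Type*} [Unique ι] {V : ι → Type*}
    (G : (i : ι) → Digraph (V i)) : Isomorphic (disjUnion G) (G default) :=
  ⟨RelIso.symm ⟨(Equiv.uniqueSigma V).symm, unionAdj_mk_iff⟩⟩

theorem isomorphic_disjSum_of_isEmpty {V W : Type*} [IsEmpty V] (G : Digraph V) (C : Digraph W) :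
    Isomorphic (disjSum G C) C :=
  ⟨RelIso.symm ⟨(Equiv.emptySum V W).symm, Sum.liftRel_inr_inr⟩⟩

theorem isomorphic_disjUnion_fin_three {V : Fin 3 → Type*} {W : Type*}
    (G : (k : Fin 3) → Digraph (V k)) (C : Digraph W) :
    Isomorphic (disjSum (disjUnion G) C)
      (disjSum (disjSum (G 0) (G 1)) (disjSum (G 2) C)) := by
  let f : (V 0 ⊕ V 1) ⊕ (V 2 ⊕ W) → (Σ k, V k) ⊕ W :=
    Sum.elim (Sum.elim (fun x => Sum.inl ⟨0, x⟩) fun x => Sum.inl ⟨1, x⟩)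
      (Sum.elim (fun x => Sum.inl ⟨2, x⟩) Sum.inr)
  have hf : Function.Bijective f := by
    constructor
    · rintro ((x | x) | (x | x)) ((y | y) | (y | y)) h <;> cases h <;> rfl
    · rintro (⟨k, x⟩ | x)
      · fin_cases k
        exacts [⟨Sum.inl (Sum.inl x), rfl⟩, ⟨Sum.inl (Sum.inr x), rfl⟩, ⟨Sum.inr (Sum.inl x), rfl⟩]
      · exact ⟨Sum.inr (Sum.inr x), rfl⟩
  have hadj : ∀ x y, (disjSum (disjUnion G) C).Adj (f x) (f y) ↔
      (disjSum (disjSum (G 0) (G 1)) (disjSum (G 2) C)).Adj x y := by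
    rintro ((x | x) | (x | x)) ((y | y) | (y | y)) <;>
      simp only [f, disjSum, disjUnion, Sum.elim_inl, Sum.elim_inr, Sum.liftRel_inl_inl,
        Sum.liftRel_inr_inr, Sum.not_liftRel_inl_inr, Sum.not_liftRel_inr_inl, unionAdj_mk_iff,
        iff_false] <;>
      exact fun h => absurd h.fst_eq (by simp)
  exact ⟨(RelIso.mk (Equiv.ofBijective f hf) (hadj _ _)).symm⟩

theorem isomorphic_cycleFamily_one_disjSum (c t : ℕ) (T : RTree) {W : Type*} (C : Digraph W) :
    Isomorphic (disjSum (cycleFamily c 1 t T) C) C := by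
  have : IsEmpty {d : ℕ // d ∣ 1 ∧ d ≠ 1} := ⟨fun d => d.2.2 (Nat.dvd_one.1 d.2.1)⟩
  exact isomorphic_disjSum_of_isEmpty _ _

theorem isomorphic_cycleFamily_prime (c t : ℕ) {p : ℕ} (T : RTree) (hp : p.Prime) :
    Isomorphic (cycleFamily c p t T) (copies (c * (p - 1) / ord p t) (Cyc (ord p t) T)) := by
  let _ : Unique {d : ℕ // d ∣ p ∧ d ≠ 1} :=
    { default := ⟨p, dvd_rfl, hp.ne_one⟩
      uniq := fun d => Subtype.ext (((Nat.dvd_prime hp).1 d.2.1).resolve_left d.2.2) }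
  rw [← Nat.totient_prime hp]
  exact isomorphic_disjUnion_of_unique fun d : {d : ℕ // d ∣ p ∧ d ≠ 1} =>
    copies (c * Nat.totient d / ord d t) (Cyc (ord d t) T)

end Isomorphic

section ProjGenLinGroup

theorem RTree.coe_forest_smul (k : ℕ) (T : RTree) :
    ((k • T).forest : Multiset RTree) = k • (T.forest : Multiset RTree) := by
  change (((List.replicate k T.forest).flatten : List RTree) : Multiset RTree) = _
  induction k with
  | zero => rw [List.replicate_zero, List.flatten_nil, zero_nsmul, Multiset.coe_nil]
  | succ k ih => rw [List.replicate_succ, List.flatten_cons, ← Multiset.coe_add, ih, succ_nsmul']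

theorem RTree.coe_forest_add (S T : RTree) :
    ((S + T).forest : Multiset RTree) = (S.forest : Multiset RTree) + (T.forest : Multiset RTree) :=
  rfl

theorem RTree.elementary_one : elementary [1] = bullet := rfl

theorem RTree.add_smul_bullet (S : RTree) (k : ℕ) : S + k • bullet = S := by
  obtain ⟨F⟩ := S
  change node (F ++ (List.replicate k []).flatten) = node F
  rw [List.flatten_replicate_nil, List.append_nil]

theorem isomorphic_pow_projGenLinGroup {F : Type*} [Field F] [Finite F] (p : ℕ) [Fact p.Prime]
    [CharP F p] {t ω₁ ω₂ ω₃ : ℕ} {v₁ v₂ v₃ : List ℕ}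
    (h₁ : IsKernelSeq t (Nat.card F - 1) ω₁ v₁) (h₂ : IsKernelSeq t (Nat.card F + 1) ω₂ v₂)
    (h₃ : IsKernelSeq t p ω₃ v₃) {d₁ d₂ d₃ : ℕ} (hd₁ : d₁ = Nat.card F * (Nat.card F + 1) / 2)
    (hd₂ : d₂ = Nat.card F * (Nat.card F - 1) / 2) (hd₃ : d₃ = (Nat.card F ^ 2 - 1) / (p - 1)) :
    Isomorphic (functionalGraph fun g : PGL(2, F) => g ^ t)
      (disjSum
        (disjSum (cycleFamily d₁ ω₁ t (RTree.elementary v₁))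
          (cycleFamily d₂ ω₂ t (RTree.elementary v₂)))
        (disjSum (cycleFamily d₃ ω₃ t (RTree.elementary v₃))
          (Cyc 1 (d₁ • RTree.elementary v₁ + d₂ • RTree.elementary v₂ +
            d₃ • RTree.elementary v₃)))) := by
  obtain ⟨τ, hpartition, hcount⟩ := exists_isCyclicPartition_natCard_eq (F := F) p
  rw [← hd₁, ← hd₂, ← hd₃] at hcount
  have hv (k : Fin 3) :
      IsKernelSeq t (![Nat.card F - 1, Nat.card F + 1, p] k) (![ω₁, ω₂, ω₃] k)
        (![v₁, v₂, v₃] k) := by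
    fin_cases k
    exacts [h₁, h₂, h₃]
  refine (hpartition.isomorphic_pow hcount hv ?_).trans (isomorphic_disjUnion_fin_three _ _)
  rw [Fin.sum_univ_three]
  simp only [RTree.coe_forest_add, RTree.coe_forest_smul, Matrix.cons_val]

end ProjGenLinGroup

end PowerMapGraph

open PowerMapGraph in
theorem mainTheorem10_general (p s q t : ℕ) (hp : p.Prime) (hq : q = p ^ s)
    (F : Type*) [Field F] (hF : Nat.card F = q)
    (ν₁ ω₁ ν₂ ω₂ : ℕ)
    (h₁ : q - 1 = ν₁ * ω₁) (hω₁ : IsGreatest {d : ℕ | d ∣ q - 1 ∧ Nat.Coprime d t} ω₁)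
    (h₂ : q + 1 = ν₂ * ω₂) (hω₂ : IsGreatest {d : ℕ | d ∣ q + 1 ∧ Nat.Coprime d t} ω₂)
    (d₁ d₂ : ℕ) (hd₁ : d₁ = q * (q + 1) / 2) (hd₂ : d₂ = q * (q - 1) / 2)
    (T₁ T₂ : RTree)
    (hT₁ : T₁ = RTree.elementary (iteratedGcd t ν₁))
    (hT₂ : T₂ = RTree.elementary (iteratedGcd t ν₂)) :
    (p ∣ t →
      Isomorphic
        (functionalGraph fun g : PGL(2, F) => g ^ t)
        (disjSum
          (disjSum
            (cycleFamily d₁ ω₁ t T₁)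
            (cycleFamily d₂ ω₂ t T₂))
          (Cyc 1
            (d₁ • T₁ + d₂ • T₂ +
              ((q ^ 2 - 1) / (p - 1)) • RTree.elementary [p])))) ∧
    (¬ p ∣ t →
      Isomorphic
        (functionalGraph fun g : PGL(2, F) => g ^ t)
        (disjSum
          (disjSum
            (cycleFamily d₁ ω₁ t T₁)
            (cycleFamily d₂ ω₂ t T₂))
          (disjSum
            (copies ((q ^ 2 - 1) / ord p t)
              (Cyc (ord p t) RTree.bullet))
            (Cyc 1 (d₁ • T₁ + d₂ • T₂))))) := by
  subst hF hT₁ hT₂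
  have hprime : Fact p.Prime := ⟨hp⟩
  have hfinite : Finite F := Nat.finite_of_card_ne_zero (hq ▸ (pow_pos hp.pos s).ne')
  have hfintype := Fintype.ofFinite F
  have hchar : CharP F p :=
    charP_of_card_eq_prime_pow (Nat.card_eq_fintype_card.symm.trans hq)
  have hdvd : p - 1 ∣ Nat.card F ^ 2 - 1 := by
    simpa only [hq, ← pow_mul, one_pow] using Nat.sub_dvd_pow_sub_pow p 1 (s * 2)
  have hkernel₁ := isKernelSeq_iteratedGcd (Nat.sub_pos_of_lt Finite.one_lt_card) h₁ hω₁
  have hkernel₂ := isKernelSeq_iteratedGcd (Nat.succ_pos _) h₂ hω₂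
  constructor <;> intro hpt
  · have hpow := isomorphic_pow_projGenLinGroup p hkernel₁ hkernel₂
      (isKernelSeq_prime_of_dvd hp hpt) hd₁ hd₂ rfl
    exact hpow.trans ((Isomorphic.refl _).disjSum (isomorphic_cycleFamily_one_disjSum _ t _ _))
  · have hpow := isomorphic_pow_projGenLinGroup p hkernel₁ hkernel₂
      (isKernelSeq_of_coprime hp.pos (hp.coprime_iff_not_dvd.2 hpt).symm) hd₁ hd₂ rfl
    have hcycles := isomorphic_cycleFamily_prime ((Nat.card F ^ 2 - 1) / (p - 1)) t RTree.bullet hp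
    rw [Nat.div_mul_cancel hdvd] at hcycles
    rw [RTree.elementary_one, RTree.add_smul_bullet] at hpow
    exact hpow.trans ((Isomorphic.refl _).disjSum (hcycles.disjSum (Isomorphic.refl _)))

theorem mainTheorem10 (p s q t : ℕ) (hp : p.Prime) (hq : q = p ^ s) (hq4 : 4 ≤ q) (ht : 0 < t)
    (F : Type*) [Field F] (hF : Nat.card F = q)
    (ν₁ ω₁ ν₂ ω₂ : ℕ)
    (h₁ : q - 1 = ν₁ * ω₁) (hω₁ : IsGreatest {d : ℕ | d ∣ q - 1 ∧ Nat.Coprime d t} ω₁)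
    (h₂ : q + 1 = ν₂ * ω₂) (hω₂ : IsGreatest {d : ℕ | d ∣ q + 1 ∧ Nat.Coprime d t} ω₂)
    (d₁ d₂ : ℕ) (hd₁ : d₁ = q * (q + 1) / 2) (hd₂ : d₂ = q * (q - 1) / 2)
    (T₁ T₂ : PowerMapGraph.RTree)
    (hT₁ : T₁ = PowerMapGraph.RTree.elementary (PowerMapGraph.iteratedGcd t ν₁))
    (hT₂ : T₂ = PowerMapGraph.RTree.elementary (PowerMapGraph.iteratedGcd t ν₂)) :
    (p ∣ t →
      PowerMapGraph.Isomorphic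
        (PowerMapGraph.functionalGraph fun g : PGL(2, F) => g ^ t)
        (PowerMapGraph.disjSum
          (PowerMapGraph.disjSum
            (PowerMapGraph.cycleFamily d₁ ω₁ t T₁)
            (PowerMapGraph.cycleFamily d₂ ω₂ t T₂))
          (PowerMapGraph.Cyc 1
            (d₁ • T₁ + d₂ • T₂ +
              ((q ^ 2 - 1) / (p - 1)) • PowerMapGraph.RTree.elementary [p])))) ∧
    (¬ p ∣ t →
      PowerMapGraph.Isomorphic
        (PowerMapGraph.functionalGraph fun g : PGL(2, F) => g ^ t)
        (PowerMapGraph.disjSum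
          (PowerMapGraph.disjSum
            (PowerMapGraph.cycleFamily d₁ ω₁ t T₁)
            (PowerMapGraph.cycleFamily d₂ ω₂ t T₂))
          (PowerMapGraph.disjSum
            (PowerMapGraph.copies ((q ^ 2 - 1) / PowerMapGraph.ord p t)
              (PowerMapGraph.Cyc (PowerMapGraph.ord p t) PowerMapGraph.RTree.bullet))
            (PowerMapGraph.Cyc 1 (d₁ • T₁ + d₂ • T₂))))) :=
  mainTheorem10_general p s q t hp hq F hF ν₁ ω₁ ν₂ ω₂ h₁ hω₁ h₂ hω₂ d₁ d₂ hd₁ hd₂ T₁ T₂ hT₁ hT₂
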